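/- For a domain (nonempty connected open set) $D\subset\mathbb C$ and $p\in D$, let $$s_D(p)=\sup_f\ \sup\{r>0:\ \Delta(0,r)\subset f(D)\},$$ where $f$ ranges over all holomorphic open embeddings (injective holomorphic maps) $f:D\to\Delta$ with $f(p)=0$; here $\Delta(0,r)=\{|w|<r\}$, $\Delta=\Delta(0,1)$, and $s_D(p)=0$ if no such $f$ exists. The domain $D$ is called holomorphic homogeneous regular if there is $c>0$ with $s_D(z)\ge c$ for all $z\in D$. Let $\hat{\mathbb C}=\mathbb C\cup\{\infty\}$ be the Riemann sphere and let $\partial D$ be the boundary of $D$ in $\hat{\mathbb C}$. We write $\lim_{z\to\partial D}s_D(z)=1$ if for every $\varepsilon>0$ there is a neighborhood $V$ of $\partial D$ in $\hat{\mathbb C}$ with $|s_D(z)-1|<\varepsilon$ for all $z\in D\cap V$. (1) Let $D\subset\mathbb C$ be a domain such that $\hat{\mathbb C}\setminus D$ has finitely many connected components, none of which is a single point. Then $\lim_{z\to\partial D}s_D(z)=1$. In particular, $D$ is a holomorphic homogeneous regular domain. (2) Let $D\subset\mathbb C$ be a bounded domain with smooth ($C^\infty$) boundary, that is, every $p\in\partial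 D$ has an open neighborhood $U$ with a $C^\infty$ function $\rho:U\to\mathbb R$ such that $d\rho\neq0$ on $U$ and $D\cap U=\{z\in U:\rho(z)<0\}$. Then $\lim_{z\to\partial D}s_D(z)=1$. In particular, $D$ is a holomorphic homogeneous regular domain. -/

import Mathlib

open Set Filter Topology

namespace Squeezing

noncomputable section

/-- A domain: a nonempty connected open set. -/
def IsDomainSet {X : Type*} [TopologicalSpace X] (D : Set X) : Prop :=
  IsOpen D ∧ IsConnected D

/-- `f` restricts to an (open) holomorphic embedding of `D` into the open unit ball, with
`f p = 0`.  Only the values of `f` on `D` matter. -/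
structure IsEmbeddingAt {E : Type*} [NormedAddCommGroup E] [NormedSpace ℂ E]
    (D : Set E) (p : E) (f : E → E) : Prop where
  differentiableOn : DifferentiableOn ℂ f D
  isOpenEmbedding : IsOpenEmbedding (Set.domRestrict D f)
  mapsTo : MapsTo f D (Metric.ball 0 1)
  map_base : f p = 0

/-- `s_D(p, f) = sup {r | B(0, r) ⊆ f(D)}`. -/
def squeezingRadius {E : Type*} [NormedAddCommGroup E] [NormedSpace ℂ E]
    (D : Set E) (f : E → E) : ℝ :=
  sSup {r : ℝ | 0 < r ∧ Metric.ball (0 : E) r ⊆ f '' D}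

/-- The squeezing function `s_D(p) = sup_f s_D(p, f)`, the supremum being over all holomorphic
embeddings `f` of `D` into the unit ball with `f p = 0`.  For `E = ℂ` this is the planar case, for
`E = EuclideanSpace ℂ (Fin n)` the case of `ℂⁿ`.  The value is `0` if there are no such `f`. -/
def squeezingFunction {E : Type*} [NormedAddCommGroup E] [NormedSpace ℂ E]
    (D : Set E) (p : E) : ℝ :=
  sSup {s : ℝ | ∃ f : E → E, IsEmbeddingAt D p f ∧ s = squeezingRadius D f}

/-- A holomorphic homogeneous regular domain: a domain whose squeezing function has a positive
lower bound.  (Such a domain is biholomorphic to a bounded one, as an embedding into the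
ball exists.) -/
def IsHolomorphicHomogeneousRegular {E : Type*} [NormedAddCommGroup E] [NormedSpace ℂ E]
    (D : Set E) : Prop :=
  IsDomainSet D ∧ ∃ c : ℝ, 0 < c ∧ ∀ z ∈ D, c ≤ squeezingFunction D z

/-- A plane set as a subset of the Riemann sphere `OnePoint ℂ`. -/
def toSphere (D : Set ℂ) : Set (OnePoint ℂ) := (fun z : ℂ => (z : OnePoint ℂ)) '' D

/-- The connected components of the complement of `D` in the Riemann sphere. -/
def complementComponents (D : Set ℂ) : Set (Set (OnePoint ℂ)) :=
  {C | ∃ x ∈ (toSphere D)ᶜ, C = connectedComponentIn (toSphere D)ᶜ x}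

/-- The filter of `z → ∂D` with `z ∈ D`; the boundary is taken in the Riemann sphere, and neighborhoods
are those of the whole set `∂D`. -/
def towardBoundary (D : Set ℂ) : Filter ℂ :=
  comap (fun z : ℂ => (z : OnePoint ℂ)) (𝓝ˢ (frontier (toSphere D))) ⊓ 𝓟 D

/-- `D` has smooth (`C^∞`) boundary: near each boundary point, `D` is the negative set of a smooth
real function with nonvanishing differential. -/
def HasSmoothBoundary (D : Set ℂ) : Prop :=
  ∀ p ∈ frontier D, ∃ (U : Set ℂ) (ρ : ℂ → ℝ), IsOpen U ∧ p ∈ U ∧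
    ContDiffOn ℝ ((⊤ : ℕ∞) : WithTop ℕ∞) ρ U ∧
    (∀ z ∈ U, fderiv ℝ ρ z ≠ 0) ∧ D ∩ U = {z ∈ U | ρ z < 0}

end

end Squeezing

namespace Squeezing

/-! Fix a boundary point p, let K be its complementary component, and use a Möbius map to send p to
∞ and another point of K to 0. The complement of K becomes a plane domain Ω that omits 0 and has
connected complement. The other complementary components form a closed set missing p, so they become
bounded. A square root followed by an inversion embeds Ω in the punctured disc, as U say; points
near 0 in U come from points near ∞, and the other components stay outside some disc of radius m.

For ζ in U near 0, take a Riemann map g of U with g(ζ) = 0. The positive harmonic function -log|z|,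
pulled back by the inverse of g, is huge at the centre. By Harnack it still exceeds -log m on any
fixed disc of radius r < 1. So this disc is covered by points of U of modulus less than m, and these
come from D. Hence the squeezing function is at least r near p (`eventually_exists_embedding`).

The Riemann map only has to cover discs of radius less than 1, so no limit of maps is taken: Koebe's
square root step enlarges the covered disc by a definite factor as long as its radius is bounded
away from 1. Simple connectivity is used as connectedness of the complement in the sphere. This
gives logarithms (`HasConnectedCompl.exists_log_sub`) and survives Möbius maps and square roots
(`HasConnectedCompl.image_sqrt`).

Homogeneous regularity then follows by compactness of the sphere. Smoothly bounded domains reduce to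
the first case, because near each point their complement lies in a nondegenerate connected part of
it. -/

/-! ### Möbius maps of the Riemann sphere. -/

theorem tendsto_coe_cobounded : Tendsto (fun z : ℂ => (z : OnePoint ℂ)) (Bornology.cobounded ℂ)
    (𝓝 OnePoint.infty) := by
  rw [Metric.cobounded_eq_cocompact, ← coclosedCompact_eq_cocompact]
  exact OnePoint.tendsto_coe_infty

open Classical in
/-- The inversion `z ↦ z⁻¹` of the Riemann sphere. -/
noncomputable def sphereInv : OnePoint ℂ → OnePoint ℂ
  | OnePoint.infty => ((0 : ℂ) : OnePoint ℂ)
  | OnePoint.some z => if z = 0 then OnePoint.infty else ((z⁻¹ : ℂ) : OnePoint ℂ)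

theorem sphereInv_infty : sphereInv OnePoint.infty = ((0 : ℂ) : OnePoint ℂ) := rfl

theorem sphereInv_zero : sphereInv ((0 : ℂ) : OnePoint ℂ) = OnePoint.infty := if_pos rfl

theorem sphereInv_coe {z : ℂ} (hz : z ≠ 0) :
    sphereInv (z : OnePoint ℂ) = ((z⁻¹ : ℂ) : OnePoint ℂ) := if_neg hz

theorem involutive_sphereInv : Function.Involutive sphereInv := by
  intro x
  induction x using OnePoint.rec with
  | infty => rw [sphereInv_infty, sphereInv_zero]
  | coe z =>
    by_cases hz : z = 0
    · rw [hz, sphereInv_zero, sphereInv_infty]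
    · rw [sphereInv_coe hz, sphereInv_coe (inv_ne_zero hz), inv_inv]

theorem continuous_sphereInv : Continuous sphereInv := by
  rw [continuous_iff_continuousAt]
  intro x
  induction x using OnePoint.rec with
  | infty =>
    rw [OnePoint.continuousAt_infty', coclosedCompact_eq_cocompact,
      ← Metric.cobounded_eq_cocompact, sphereInv_infty]
    have h : Tendsto (fun z : ℂ => ((z⁻¹ : ℂ) : OnePoint ℂ)) (Bornology.cobounded ℂ)
        (𝓝 ((0 : ℂ) : OnePoint ℂ)) :=
      (OnePoint.continuous_coe.tendsto _).comp tendsto_inv₀_cobounded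
    refine h.congr' ?_
    filter_upwards [Bornology.eventually_ne_cobounded (0 : ℂ)] with z hz
    exact (sphereInv_coe hz).symm
  | coe z =>
    rw [OnePoint.continuousAt_coe]
    by_cases hz : z = 0
    · subst hz
      rw [continuousAt_iff_punctured_nhds]
      simp only [Function.comp_apply, sphereInv_zero]
      refine (tendsto_coe_cobounded.comp tendsto_inv₀_nhdsNE_zero).congr' ?_
      filter_upwards [self_mem_nhdsWithin] with z hz
      exact (sphereInv_coe hz).symm
    · have h : ContinuousAt (fun z : ℂ => ((z⁻¹ : ℂ) : OnePoint ℂ)) z :=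
        OnePoint.continuous_coe.continuousAt.comp (continuousAt_inv₀ hz)
      refine h.congr ?_
      filter_upwards [eventually_ne_nhds hz] with w hw
      exact (sphereInv_coe hw).symm

/-- The inversion as a homeomorphism. -/
noncomputable def sphereInvHomeo : OnePoint ℂ ≃ₜ OnePoint ℂ where
  toEquiv := involutive_sphereInv.toPerm
  continuous_toFun := continuous_sphereInv
  continuous_invFun := continuous_sphereInv

/-- The affine map `z ↦ a z + b` of the Riemann sphere. -/
noncomputable def sphereAffine (a b : ℂ) (ha : a ≠ 0) : OnePoint ℂ ≃ₜ OnePoint ℂ :=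
  ((Homeomorph.mulLeft₀ a ha).trans (Homeomorph.addRight b)).onePointCongr

theorem sphereAffine_coe {a b : ℂ} (ha : a ≠ 0) (z : ℂ) :
    sphereAffine a b ha z = ((a * z + b : ℂ) : OnePoint ℂ) := rfl

theorem sphereAffine_infty {a b : ℂ} (ha : a ≠ 0) :
    sphereAffine a b ha OnePoint.infty = OnePoint.infty := rfl

/-- For c ≠ 0, (az + b)/(cz + d) = a/c - ((ad - bc)/c)/(cz + d): an affine map, the inversion and
another affine map. -/
theorem exists_sphere_mobius {a b c d : ℂ} (h : a * d - b * c ≠ 0) :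
    ∃ τ : OnePoint ℂ ≃ₜ OnePoint ℂ,
      (∀ z : ℂ, c * z + d ≠ 0 → τ z = (((a * z + b) / (c * z + d) : ℂ) : OnePoint ℂ)) ∧
      (∀ z : ℂ, c * z + d = 0 → τ z = OnePoint.infty) ∧
      (c ≠ 0 → τ OnePoint.infty = ((a / c : ℂ) : OnePoint ℂ)) ∧
      (c = 0 → τ OnePoint.infty = OnePoint.infty) := by
  by_cases hc : c = 0
  · subst hc
    have had : a * d ≠ 0 := by simpa using h
    have ha : a ≠ 0 := left_ne_zero_of_mul had
    have hd : d ≠ 0 := right_ne_zero_of_mul had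
    refine ⟨sphereAffine (a / d) (b / d) (div_ne_zero ha hd), fun z _ => ?_, fun z hz => ?_,
      fun h => absurd rfl h, fun _ => sphereAffine_infty _⟩
    · rw [sphereAffine_coe, zero_mul, zero_add, add_div, div_mul_eq_mul_div]
    · simp [hd] at hz
  · have hk : -(a * d - b * c) / c ≠ 0 := div_ne_zero (neg_ne_zero.2 h) hc
    have key : ∀ x, ((sphereAffine c d hc).trans (sphereInvHomeo.trans
        (sphereAffine (-(a * d - b * c) / c) (a / c) hk))) x =
        sphereAffine (-(a * d - b * c) / c) (a / c) hk (sphereInv (sphereAffine c d hc x)) :=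
      fun _ => rfl
    refine ⟨(sphereAffine c d hc).trans (sphereInvHomeo.trans
      (sphereAffine (-(a * d - b * c) / c) (a / c) hk)), fun z hz => ?_, fun z hz => ?_,
      fun _ => ?_, fun h => absurd h hc⟩
    · rw [key, sphereAffine_coe, sphereInv_coe hz, sphereAffine_coe]
      congr 1
      field_simp
      ring
    · rw [key, sphereAffine_coe, hz, sphereInv_zero, sphereAffine_infty]
    · rw [key, sphereAffine_infty, sphereInv_infty, sphereAffine_coe, mul_zero, zero_add]

/-! ### Domains with connected complement in the sphere. -/

/-- A plane domain whose complement in the Riemann sphere is connected. -/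
structure HasConnectedCompl (U : Set ℂ) : Prop where
  isOpen : IsOpen U
  isConnected : IsConnected U
  compl : IsPreconnected (toSphere U)ᶜ

theorem coe_mem_toSphere {U : Set ℂ} {z : ℂ} : (z : OnePoint ℂ) ∈ toSphere U ↔ z ∈ U :=
  OnePoint.coe_injective.mem_set_image

theorem infty_notMem_toSphere (U : Set ℂ) : OnePoint.infty ∉ toSphere U :=
  OnePoint.infty_notMem_image_coe

theorem isOpen_toSphere {U : Set ℂ} : IsOpen (toSphere U) ↔ IsOpen U := OnePoint.isOpen_image_coe

/-- A homeomorphism of the sphere that restricts to a map of plane sets. -/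
theorem HasConnectedCompl.image_of_homeomorph {U : Set ℂ} (hU : HasConnectedCompl U)
    (τ : OnePoint ℂ ≃ₜ OnePoint ℂ) {T : ℂ → ℂ}
    (hT : ∀ z ∈ U, τ z = ((T z : ℂ) : OnePoint ℂ)) : HasConnectedCompl (T '' U) := by
  have key : toSphere (T '' U) = τ '' toSphere U := by
    simp only [toSphere, image_image]
    exact image_congr fun z hz => (hT z hz).symm
  have hc : ContinuousOn T U := by
    have : ContinuousOn (fun z : ℂ => ((T z : ℂ) : OnePoint ℂ)) U :=
      (τ.continuous.comp OnePoint.continuous_coe).continuousOn.congr fun z hz => (hT z hz).symm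
    rwa [← Function.comp_def,
      ← OnePoint.isOpenEmbedding_coe.isInducing.continuousOn_iff] at this
  refine ⟨?_, hU.isConnected.image T hc, ?_⟩
  · rw [← isOpen_toSphere, key]
    exact τ.isOpenMap _ (isOpen_toSphere.2 hU.isOpen)
  · rw [key, ← image_compl_eq τ.bijective]
    exact hU.compl.image _ τ.continuous.continuousOn

theorem HasConnectedCompl.image_mobius {U : Set ℂ} (hU : HasConnectedCompl U) {a b c d : ℂ}
    (h : a * d - b * c ≠ 0) (hp : ∀ z ∈ U, c * z + d ≠ 0) :
    HasConnectedCompl ((fun z => (a * z + b) / (c * z + d)) '' U) := by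
  obtain ⟨τ, hτ, -⟩ := exists_sphere_mobius h
  exact hU.image_of_homeomorph τ fun z hz => hτ z (hp z hz)

theorem isClosed_connectedComponentIn {X : Type*} [TopologicalSpace X] {F : Set X}
    (hF : IsClosed F) (x : X) : IsClosed (connectedComponentIn F x) := by
  by_cases hx : x ∈ F
  · exact isClosed_of_closure_subset (isPreconnected_connectedComponentIn.closure
      |>.subset_connectedComponentIn (subset_closure (mem_connectedComponentIn hx))
      (closure_minimal (connectedComponentIn_subset _ _) hF))
  · rw [connectedComponentIn_eq_empty hx]
    exact isClosed_empty

/-- In a connected space, the complement of a component of the complement of a connected open set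
is connected. -/
theorem isPreconnected_compl_connectedComponentIn {X : Type*} [TopologicalSpace X]
    [PreconnectedSpace X] [NormalSpace X] {D : Set X} (hDo : IsOpen D) (hD : IsConnected D) {x : X}
    (hx : x ∈ Dᶜ) : IsPreconnected (connectedComponentIn Dᶜ x)ᶜ := by
  set K := connectedComponentIn Dᶜ x with hK
  have hKD : K ⊆ Dᶜ := connectedComponentIn_subset _ _
  have hxK : x ∈ K := mem_connectedComponentIn hx
  have hKc : IsPreconnected K := isPreconnected_connectedComponentIn
  have hKcl : IsClosed K := isClosed_connectedComponentIn hDo.isClosed_compl x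
  -- The piece v of Kᶜ missing D is absorbed by K: K ∪ (v ∩ Kᶜ) is connected and disjoint from D, so
  -- maximality of the component K leaves v ∩ Kᶜ empty.
  have main : ∀ u v : Set X, IsOpen u → IsOpen v → Kᶜ ⊆ u ∪ v → Kᶜ ∩ (u ∩ v) = ∅ → D ⊆ u →
      Kᶜ ⊆ u := by
    intro u v hu hv huv hd hDu
    have hB : IsOpen (v ∩ Kᶜ) := hv.inter hKcl.isOpen_compl
    have hA : IsOpen (u ∩ Kᶜ) := hu.inter hKcl.isOpen_compl
    have hKB : K ∪ (v ∩ Kᶜ) = (u ∩ Kᶜ)ᶜ := by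
      ext y
      have h1 := @huv y
      have h2 : y ∉ Kᶜ ∩ (u ∩ v) := by simp [hd]
      simp only [mem_union, mem_inter_iff, mem_compl_iff] at *
      tauto
    have hKBc : IsClosed (K ∪ (v ∩ Kᶜ)) := hKB ▸ hA.isClosed_compl
    -- The part in C₂ misses K, so it is both closed and open in the whole connected space, hence
    -- empty.
    have hsep : ∀ C₁ C₂ : Set X, IsClosed C₁ → IsClosed C₂ → K ∪ (v ∩ Kᶜ) ⊆ C₁ ∪ C₂ →
        Disjoint C₁ C₂ → K ⊆ C₁ → K ∪ (v ∩ Kᶜ) ⊆ C₁ := by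
      intro C₁ C₂ h1 h2 hc hdis hKC
      have heq : C₂ ∩ (K ∪ (v ∩ Kᶜ)) = (v ∩ Kᶜ) ∩ C₁ᶜ := by
        ext y
        have a1 := @hc y
        have a2 := @hKC y
        have a3 : y ∈ C₁ → y ∉ C₂ := fun h h' => (disjoint_left.1 hdis) h h'
        simp only [mem_union, mem_inter_iff, mem_compl_iff] at *
        tauto
      have hclopen : IsClopen (C₂ ∩ (K ∪ (v ∩ Kᶜ))) :=
        ⟨h2.inter hKBc, heq ▸ hB.inter h1.isOpen_compl⟩
      rcases isClopen_iff.1 hclopen with h | h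
      · intro y hy
        rcases hc hy with h' | h'
        · exact h'
        · exact absurd (h ▸ ⟨h', hy⟩ : y ∈ (∅ : Set X)) (notMem_empty y)
      · have : x ∈ C₂ ∩ (K ∪ (v ∩ Kᶜ)) := h ▸ mem_univ x
        rw [heq] at this
        exact absurd hxK this.1.2
    have hconn : IsPreconnected (K ∪ (v ∩ Kᶜ)) := by
      rw [isPreconnected_iff_subset_of_fully_disjoint_closed hKBc]
      intro C₁ C₂ h1 h2 hc hdis
      rcases (isPreconnected_iff_subset_of_fully_disjoint_closed hKcl).1 hKc C₁ C₂ h1 h2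
        (subset_union_left.trans hc) hdis with h | h
      · exact Or.inl (hsep C₁ C₂ h1 h2 hc hdis h)
      · exact Or.inr (hsep C₂ C₁ h2 h1 (union_comm C₁ C₂ ▸ hc) hdis.symm h)
    have hsub : K ∪ (v ∩ Kᶜ) ⊆ K := by
      refine hconn.subset_connectedComponentIn (Or.inl hxK) ?_
      rintro y (hy | ⟨hyv, hyK⟩) hyD
      · exact hKD hy hyD
      · exact (hd ▸ ⟨hyK, hDu hyD, hyv⟩ : y ∈ (∅ : Set X))
    intro y hy
    rcases huv hy with h | h
    · exact h
    · exact absurd (hsub (Or.inr ⟨h, hy⟩)) hy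
  rw [isPreconnected_iff_subset_of_disjoint]
  intro u v hu hv huv hd
  have hDK : D ⊆ Kᶜ := fun y hy hy' => hKD hy' hy
  have := (isPreconnected_iff_subset_of_disjoint.1 hD.isPreconnected) u v hu hv (hDK.trans huv)
    (subset_empty_iff.1 fun y hy => (hd ▸ ⟨hDK hy.1, hy.2⟩ : y ∈ (∅ : Set X)))
  rcases this with h | h
  · exact Or.inl (main u v hu hv huv hd h)
  · exact Or.inr (main v u hv hu (union_comm u v ▸ huv) (inter_comm u v ▸ hd) h)

/-! ### Holomorphic logarithms. -/

theorem eqOn_of_exp_eq {V : Set ℂ} (hV : IsOpen V) (hVc : IsPreconnected V) {f g : ℂ → ℂ}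
    (hf : DifferentiableOn ℂ f V) (hg : DifferentiableOn ℂ g V)
    (h : ∀ z ∈ V, Complex.exp (f z) = Complex.exp (g z)) {x : ℂ} (hx : x ∈ V)
    (hfg : f x = g x) : EqOn f g V := by
  refine hV.eqOn_of_deriv_eq hVc hf hg (fun z hz => ?_) hx hfg
  have h1 := ((hf z hz).differentiableAt (hV.mem_nhds hz)).hasDerivAt.cexp
  have h2 := ((hg z hz).differentiableAt (hV.mem_nhds hz)).hasDerivAt.cexp
  have h3 := h1.unique (h2.congr_of_eventuallyEq
    (eventually_of_mem (hV.mem_nhds hz) fun w hw => h w hw))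
  rw [h z hz] at h3
  exact mul_left_cancel₀ (Complex.exp_ne_zero _) h3

/-- Two points of a plane domain lie in a relatively compact subdomain. -/
theorem exists_relatively_compact_subdomain {U : Set ℂ} (hU : IsOpen U) (hUc : IsPreconnected U)
    {x y : ℂ} (hx : x ∈ U) (hy : y ∈ U) :
    ∃ V C : Set ℂ, IsOpen V ∧ IsPreconnected V ∧ x ∈ V ∧ y ∈ V ∧ V ⊆ C ∧ IsCompact C ∧ C ⊆ U := by
  refine hUc.induction₂ (fun x y => ∃ V C : Set ℂ, IsOpen V ∧ IsPreconnected V ∧ x ∈ V ∧ y ∈ V ∧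
    V ⊆ C ∧ IsCompact C ∧ C ⊆ U) ?_ ?_ ?_ hx hy
  · intro z hz
    obtain ⟨r, hr, hrU⟩ := Metric.nhds_basis_closedBall.mem_iff.1 (hU.mem_nhds hz)
    filter_upwards [mem_nhdsWithin_of_mem_nhds (Metric.ball_mem_nhds z hr)] with w hw
    exact ⟨Metric.ball z r, Metric.closedBall z r, Metric.isOpen_ball,
      Metric.isPreconnected_ball, Metric.mem_ball_self hr, hw, Metric.ball_subset_closedBall,
      isCompact_closedBall z r, hrU⟩
  · rintro a b c - - - ⟨V, C, h1, h2, h3, h4, h5, h6, h7⟩ ⟨V', C', k1, k2, k3, k4, k5, k6, k7⟩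
    exact ⟨V ∪ V', C ∪ C', h1.union k1, h2.union b h4 k3 k2, Or.inl h3, Or.inr k4,
      union_subset_union h5 k5, h6.union k6, union_subset h7 k7⟩
  · rintro a b - - ⟨V, C, h1, h2, h3, h4, h⟩
    exact ⟨V, C, h1, h2, h4, h3, h⟩

/-- Logarithms on compact subsets of a domain glue to a logarithm on the domain. -/
theorem exists_log_of_forall_isCompact {U : Set ℂ} (hU : IsOpen U) (hUc : IsPreconnected U)
    {f : ℂ → ℂ} (h : ∀ C ⊆ U, IsCompact C → ∃ ℓ : ℂ → ℂ, DifferentiableOn ℂ ℓ C ∧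
      ∀ z ∈ C, Complex.exp (ℓ z) = f z) :
    ∃ L : ℂ → ℂ, DifferentiableOn ℂ L U ∧ ∀ z ∈ U, Complex.exp (L z) = f z := by
  rcases U.eq_empty_or_nonempty with rfl | ⟨x, hx⟩
  · exact ⟨0, differentiableOn_empty, fun z hz => absurd hz (notMem_empty z)⟩
  -- Fixing the value at the base point x makes the logarithm unique on a connected open set
  -- containing x, which is what lets the pieces agree.
  have key : ∀ C ⊆ U, IsCompact C → x ∈ C → ∃ ℓ : ℂ → ℂ, DifferentiableOn ℂ ℓ C ∧
      (∀ z ∈ C, Complex.exp (ℓ z) = f z) ∧ ℓ x = Complex.log (f x) := by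
    intro C hCU hC hxC
    obtain ⟨ℓ, h1, h2⟩ := h C hCU hC
    refine ⟨fun z => ℓ z + (Complex.log (f x) - ℓ x), h1.add_const _, fun z hz => ?_, by ring⟩
    rw [Complex.exp_add, Complex.exp_sub, Complex.exp_log, h2 z hz, h2 x hxC, div_self, mul_one]
    all_goals
      rw [← h2 x hxC]
      exact Complex.exp_ne_zero _
  choose! V C hV hVc hxV hzV hVC hC hCU using
    fun z (hz : z ∈ U) => exists_relatively_compact_subdomain hU hUc hx hz
  choose! ℓ hℓ hexp hℓx using fun z (hz : z ∈ U) =>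
    key (C z) (hCU z hz) (hC z hz) (hVC z hz (hxV z hz))
  have heq : ∀ z ∈ U, ∀ w ∈ V z, ℓ w w = ℓ z w := by
    intro z hz w hw
    have hwU : w ∈ U := hCU z hz (hVC z hz hw)
    obtain ⟨g, hg, hge, hgx⟩ := key (C z ∪ C w) (union_subset (hCU z hz) (hCU w hwU))
      ((hC z hz).union (hC w hwU)) (Or.inl (hVC z hz (hxV z hz)))
    have e : ∀ y ∈ U, C y ⊆ C z ∪ C w → EqOn (ℓ y) g (V y) := fun y hy hsub =>
      eqOn_of_exp_eq (hV y hy) (hVc y hy) ((hℓ y hy).mono (hVC y hy))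
        (hg.mono ((hVC y hy).trans hsub))
        (fun u hu => by rw [hexp y hy u (hVC y hy hu), hge u (hsub (hVC y hy hu))]) (hxV y hy)
        (by rw [hℓx y hy, hgx])
    rw [e w hwU subset_union_right (hzV w hwU), e z hz subset_union_left hw]
  refine ⟨fun z => ℓ z z, fun z hz => ?_, fun z hz => hexp z hz z (hVC z hz (hzV z hz))⟩
  have hd : DifferentiableAt ℂ (ℓ z) z :=
    ((hℓ z hz).mono (hVC z hz) z (hzV z hz)).differentiableAt ((hV z hz).mem_nhds (hzV z hz))
  exact (hd.congr_of_eventuallyEq (eventually_of_mem ((hV z hz).mem_nhds (hzV z hz))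
    fun w hw => heq z hz w hw)).differentiableWithinAt

/-- The linear function `z - k` vanishing at the point `k`, or `1` for `k = ∞`. -/
noncomputable def linearFactor (k : OnePoint ℂ) (z : ℂ) : ℂ := k.elim 1 (fun k => z - k)

theorem linearFactor_infty (z : ℂ) : linearFactor OnePoint.infty z = 1 := rfl

theorem linearFactor_coe (k z : ℂ) : linearFactor (k : OnePoint ℂ) z = z - k := rfl

/-- The quotient of the linear factors at two nearby points has a logarithm. -/
theorem eventually_exists_log_linearFactor {C : Set ℂ} (hC : IsCompact C) {x : OnePoint ℂ}
    (hx : x ∉ toSphere C) : ∀ᶠ y in 𝓝 x, ∃ ℓ : ℂ → ℂ, DifferentiableOn ℂ ℓ C ∧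
      ∀ z ∈ C, linearFactor y z = Complex.exp (ℓ z) * linearFactor x z := by
  have hlog : ∀ u : ℂ → ℂ, DifferentiableOn ℂ u C → (∀ z ∈ C, ‖u z‖ < 1) →
      DifferentiableOn ℂ (fun z => Complex.log (1 + u z)) C ∧
      ∀ z ∈ C, Complex.exp (Complex.log (1 + u z)) = 1 + u z := by
    intro u hu hlt
    have hs : ∀ z ∈ C, 1 + u z ∈ Complex.slitPlane := fun z hz =>
      Complex.mem_slitPlane_of_norm_lt_one (hlt z hz)
    exact ⟨(hu.const_add 1).clog hs, fun z hz => Complex.exp_log (Complex.slitPlane_ne_zero (hs z hz))⟩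
  induction x using OnePoint.rec with
  | infty =>
    obtain ⟨M, hM⟩ := hC.isBounded.exists_norm_le
    rw [OnePoint.nhds_infty_eq, eventually_sup, eventually_map, coclosedCompact_eq_cocompact,
      ← Metric.cobounded_eq_cocompact]
    refine ⟨?_, ?_⟩
    -- For large k, z - k = (-k)(1 - z/k) with |z/k| < 1 on C.
    · filter_upwards [tendsto_norm_cobounded_atTop.eventually_gt_atTop (max M 0)] with k hk
      have hk0 : k ≠ 0 := norm_pos_iff.1 ((le_max_right _ _).trans_lt hk)
      obtain ⟨h1, h2⟩ := hlog (fun z => -(z / k)) (by fun_prop) (fun z hz => by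
        rw [norm_neg, norm_div, div_lt_one (norm_pos_iff.2 hk0)]
        exact (hM z hz).trans_lt ((le_max_left _ _).trans_lt hk))
      refine ⟨fun z => Complex.log (-k) + Complex.log (1 + -(z / k)), h1.const_add _,
        fun z hz => ?_⟩
      rw [Complex.exp_add, h2 z hz, Complex.exp_log (neg_ne_zero.2 hk0), linearFactor_infty,
        linearFactor_coe]
      field_simp
      ring
    · refine eventually_pure.2 ⟨0, differentiableOn_const 0, fun z _ => ?_⟩
      simp
  | coe k =>
    have hk : k ∉ C := fun h => hx (mem_image_of_mem _ h)
    obtain ⟨r, hr, hrC⟩ := Metric.nhds_basis_ball.mem_iff.1 (hC.isClosed.isOpen_compl.mem_nhds hk)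
    rw [OnePoint.nhds_coe_eq, eventually_map]
    filter_upwards [Metric.ball_mem_nhds k hr] with y hy
    have hzk : ∀ z ∈ C, r ≤ ‖z - k‖ := fun z hz => by
      by_contra! h
      exact hrC (mem_ball_iff_norm.2 h) hz
    have hne : ∀ z ∈ C, z - k ≠ 0 := fun z hz => norm_pos_iff.1 (hr.trans_le (hzk z hz))
    obtain ⟨h1, h2⟩ := hlog (fun z => (k - y) / (z - k))
      ((differentiableOn_const _).div (by fun_prop) hne) (fun z hz => by
        rw [norm_div, div_lt_one (norm_pos_iff.2 (hne z hz)), ← norm_neg, neg_sub]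
        exact (mem_ball_iff_norm.1 hy).trans_le (hzk z hz))
    refine ⟨_, h1, fun z hz => ?_⟩
    rw [h2 z hz, linearFactor_coe, linearFactor_coe]
    have := hne z hz
    field_simp
    ring

/-- On a compact C ⊆ U, having a quotient of linear factors with a logarithm is an equivalence
relation on the complement, and nearby points are related. Connectedness of the complement therefore
relates ∞ to a, where the quotient is z - a. -/
theorem HasConnectedCompl.exists_log_sub {U : Set ℂ} (hU : HasConnectedCompl U) {a : ℂ}
    (ha : a ∉ U) : ∃ L : ℂ → ℂ, DifferentiableOn ℂ L U ∧ ∀ z ∈ U, Complex.exp (L z) = z - a := by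
  refine exists_log_of_forall_isCompact hU.isOpen hU.isConnected.isPreconnected fun C hCU hC => ?_
  have hsub : toSphere C ⊆ toSphere U := image_mono hCU
  obtain ⟨ℓ, hℓ, h⟩ := hU.compl.induction₂ (fun x y => ∃ ℓ : ℂ → ℂ, DifferentiableOn ℂ ℓ C ∧
      ∀ z ∈ C, linearFactor y z = Complex.exp (ℓ z) * linearFactor x z)
    (fun x hx => nhdsWithin_le_nhds
      (eventually_exists_log_linearFactor hC fun h => hx (hsub h))) (by
        rintro x y z - - - ⟨f, hf, h⟩ ⟨g, hg, k⟩
        exact ⟨fun z => f z + g z, hf.add hg, fun w hw => by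
          rw [k w hw, h w hw, Complex.exp_add]; ring⟩) (by
        rintro x y - - ⟨f, hf, h⟩
        exact ⟨fun z => -f z, hf.neg, fun w hw => by
          rw [h w hw, ← mul_assoc, ← Complex.exp_add, neg_add_cancel, Complex.exp_zero, one_mul]⟩)
    (infty_notMem_toSphere U) (mt coe_mem_toSphere.1 ha : (a : OnePoint ℂ) ∈ (toSphere U)ᶜ)
  refine ⟨ℓ, hℓ, fun z hz => ?_⟩
  rw [← linearFactor_coe, h z hz, linearFactor_infty, mul_one]

/-! ### Square roots preserve connectedness of the complement. -/

/-- Squaring on the Riemann sphere. -/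
noncomputable def sphereSq : OnePoint ℂ → OnePoint ℂ := OnePoint.map (fun z : ℂ => z ^ 2)

theorem sphereSq_coe (z : ℂ) : sphereSq z = ((z ^ 2 : ℂ) : OnePoint ℂ) := rfl

theorem sphereSq_infty : sphereSq OnePoint.infty = OnePoint.infty := rfl

theorem continuous_sphereSq : Continuous sphereSq := by
  refine OnePoint.continuous_map (by fun_prop) ?_
  rw [coclosedCompact_eq_cocompact, ← Metric.cobounded_eq_cocompact]
  exact tendsto_pow_cobounded_cobounded two_ne_zero

theorem surjective_sphereSq : Function.Surjective sphereSq := by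
  intro x
  induction x using OnePoint.rec with
  | infty => exact ⟨_, sphereSq_infty⟩
  | coe z =>
    obtain ⟨w, hw⟩ := IsAlgClosed.exists_pow_nat_eq z zero_lt_two
    exact ⟨w, by rw [sphereSq_coe, hw]⟩

theorem isClosedMap_sphereSq : IsClosedMap sphereSq := continuous_sphereSq.isClosedMap

theorem sphereSq_eq_iff {x y : OnePoint ℂ} : sphereSq x = sphereSq y ↔
    x = y ∨ x = sphereAffine (-1) 0 (neg_ne_zero.2 one_ne_zero) y := by
  induction x using OnePoint.rec with
  | infty =>
    induction y using OnePoint.rec with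
    | infty => simp
    | coe w => simp [sphereSq_infty, sphereSq_coe, sphereAffine_coe]
  | coe z =>
    induction y using OnePoint.rec with
    | infty => simp [sphereSq_infty, sphereSq_coe, sphereAffine_infty]
    | coe w =>
      rw [sphereSq_coe, sphereSq_coe, sphereAffine_coe, OnePoint.coe_eq_coe, OnePoint.coe_eq_coe,
        OnePoint.coe_eq_coe, sq_eq_sq_iff_eq_or_eq_neg]
      simp

/-- Squaring is a quotient map, and the saturation of V is V ∪ -V. -/
theorem isOpenMap_sphereSq : IsOpenMap sphereSq := by
  intro V hV
  rw [← (isClosedMap_sphereSq.isQuotientMap continuous_sphereSq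
    surjective_sphereSq).isOpen_preimage]
  have : sphereSq ⁻¹' (sphereSq '' V) =
      V ∪ sphereAffine (-1) 0 (neg_ne_zero.2 one_ne_zero) '' V := by
    ext x
    constructor
    · rintro ⟨y, hy, hxy⟩
      rcases sphereSq_eq_iff.1 hxy.symm with rfl | rfl
      · exact Or.inl hy
      · exact Or.inr (mem_image_of_mem _ hy)
    · rintro (h | ⟨y, hy, rfl⟩)
      · exact ⟨x, h, rfl⟩
      · exact ⟨y, hy, (sphereSq_eq_iff.2 (Or.inr rfl)).symm⟩
  rw [this]
  exact hV.union ((sphereAffine _ _ _).isOpenMap _ hV)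

/-- The image of a branch of the square root has connected complement. -/
theorem HasConnectedCompl.image_sqrt {U : Set ℂ} (hU : HasConnectedCompl U) (h0 : (0 : ℂ) ∉ U)
    {s : ℂ → ℂ} (hs : ContinuousOn s U) (hsq : ∀ z ∈ U, s z ^ 2 = z) :
    HasConnectedCompl (s '' U) := by
  have hq : Continuous fun w : ℂ => w ^ 2 := by fun_prop
  have hP : IsOpen ((fun w : ℂ => w ^ 2) ⁻¹' U) := hU.isOpen.preimage hq
  have hpm : ∀ w : ℂ, w ^ 2 ∈ U → s (w ^ 2) = w ∨ s (w ^ 2) = -w := fun w hw =>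
    sq_eq_sq_iff_eq_or_eq_neg.1 (hsq _ hw)
  have hne : ∀ w : ℂ, w ^ 2 ∈ U → w ≠ 0 := by
    rintro w hw rfl
    exact h0 (by simpa using hw)
  -- Over w², the two candidates for the root are w and -w; the condition s(w²) + w ≠ 0 selects w
  -- and is open.
  have himage : s '' U = (fun w : ℂ => w ^ 2) ⁻¹' U ∩ (fun w => s (w ^ 2) + w) ⁻¹' {0}ᶜ := by
    ext w
    constructor
    · rintro ⟨z, hz, rfl⟩
      refine ⟨by simpa [hsq z hz] using hz, ?_⟩
      have := hne (s z) (by rwa [hsq z hz])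
      simp only [mem_preimage, hsq z hz, mem_compl_iff, mem_singleton_iff]
      rwa [← two_mul, mul_eq_zero, not_or, and_iff_right two_ne_zero]
    · rintro ⟨hw, hw'⟩
      rcases hpm w hw with h | h
      · exact ⟨_, hw, h⟩
      · simp [h] at hw'
  have hopen : IsOpen (s '' U) := by
    rw [himage]
    refine ContinuousOn.isOpen_inter_preimage ?_ hP isOpen_compl_singleton
    exact (hs.comp hq.continuousOn fun w hw => hw).add continuousOn_id
  have hconn : IsConnected (s '' U) := hU.isConnected.image s hs
  refine ⟨hopen, hconn, ?_⟩
  set E := (toSphere (s '' U))ᶜ with hE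
  set N := toSphere ((fun z => -s z) '' U) with hN
  set X := sphereSq ⁻¹' (toSphere U)ᶜ with hX
  have hEcl : IsClosed E := (isOpen_toSphere.2 hopen).isClosed_compl
  have hKcl : IsClosed (toSphere U)ᶜ := (isOpen_toSphere.2 hU.isOpen).isClosed_compl
  have hXcl : IsClosed X := hKcl.preimage continuous_sphereSq
  have hNo : IsOpen N := by
    rw [hN, isOpen_toSphere]
    have : (fun z => -s z) '' U = (fun w => -w) '' (s '' U) := by rw [image_image]
    rw [this]
    exact (Homeomorph.neg ℂ).isOpenMap _ hopen
  have hNc : IsConnected N :=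
    (hU.isConnected.image _ hs.neg).image _ OnePoint.continuous_coe.continuousOn
  have hXE : X ⊆ E := by
    rintro x hx ⟨_, ⟨z, hz, rfl⟩, rfl⟩
    refine hx ?_
    rw [sphereSq_coe, hsq z hz]
    exact mem_image_of_mem _ hz
  have hNE : N ⊆ E := by
    rintro x ⟨_, ⟨z, hz, rfl⟩, rfl⟩ h
    obtain ⟨z', hz', h⟩ := coe_mem_toSphere.1 h
    have h1 : z' = z := by rw [← hsq z' hz', h, neg_sq, hsq z hz]
    subst h1
    have h2 : s z' = 0 := self_eq_neg.1 h
    exact hne (s z') (by rwa [hsq z' hz']) h2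
  -- The complement E of s(U) consists of X, lying over the complement of U, and the opposite branch
  -- N.
  have hEXN : E ⊆ X ∪ N := by
    intro x hx
    by_cases h : x ∈ X
    · exact Or.inl h
    · refine Or.inr ?_
      obtain ⟨y, hy, hxy⟩ := not_not.1 h
      induction x using OnePoint.rec with
      | infty => simp [sphereSq_infty] at hxy
      | coe w =>
        rw [sphereSq_coe, OnePoint.coe_eq_coe] at hxy
        subst hxy
        rcases hpm w hy with h' | h'
        · exact absurd (mem_image_of_mem _ (show w ∈ s '' U from ⟨_, hy, h'⟩)) hx
        · exact mem_image_of_mem _ ⟨_, hy, neg_eq_iff_eq_neg.2 h'⟩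
  have main : ∀ A B : Set (OnePoint ℂ), IsClosed A → IsClosed B → E ⊆ A ∪ B → Disjoint A B →
      OnePoint.infty ∈ A → E ⊆ A := by
    intro A B hA hB hAB hdis hinf
    have hd : ∀ y ∈ A, y ∉ B := fun y h h' => disjoint_left.1 hdis h h'
    have hXB : X ∩ B = ∅ := by
      by_contra hne'
      obtain ⟨b, hb⟩ := nonempty_iff_ne_empty.2 hne'
      have h1 : IsClosed (sphereSq '' (X ∩ B)) := isClosedMap_sphereSq _ (hXcl.inter hB)
      have h2 : IsOpen (sphereSq '' Aᶜ) := isOpenMap_sphereSq _ hA.isOpen_compl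
      have h3 : sphereSq '' (X ∩ B) = (toSphere U)ᶜ ∩ sphereSq '' Aᶜ := by
        ext y
        constructor
        · rintro ⟨x, ⟨hx, hxB⟩, rfl⟩
          exact ⟨hx, x, fun h => hd x h hxB, rfl⟩
        · rintro ⟨hy, x, hx, rfl⟩
          exact ⟨x, ⟨hy, (hAB (hXE hy)).resolve_left hx⟩, rfl⟩
      -- The image of X ∩ B is closed and relatively open in the connected complement of U, so if
      -- nonempty it is everything. But the only point over ∞ is ∞ itself, which lies in A.
      have h4 : (toSphere U)ᶜ ⊆ sphereSq '' Aᶜ := by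
        refine ((isPreconnected_iff_subset_of_disjoint.1 hU.compl) _ _ h2 h1.isOpen_compl ?_
          ?_).resolve_right fun h => h (show sphereSq b ∈ (toSphere U)ᶜ from hb.1) ⟨b, hb, rfl⟩
        · rw [h3]
          intro y hy
          by_cases h : y ∈ sphereSq '' Aᶜ
          · exact Or.inl h
          · exact Or.inr fun h' => h h'.2
        · rw [h3]
          exact subset_empty_iff.1 fun y hy => hy.2.2 ⟨hy.1, hy.2.1⟩
      obtain ⟨x, hx, hxi⟩ := h4 (infty_notMem_toSphere U)
      induction x using OnePoint.rec with
      | infty => exact hx hinf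
      | coe w => simp [sphereSq_coe] at hxi
    have hXA : X ⊆ A := fun x hx => (hAB (hXE hx)).resolve_right fun h =>
      (hXB ▸ ⟨hx, h⟩ : x ∈ (∅ : Set (OnePoint ℂ)))
    rcases (isPreconnected_iff_subset_of_disjoint_closed.1 hNc.isPreconnected) A B hA hB
      (hNE.trans hAB) (by rw [hdis.inter_eq, inter_empty]) with h | h
    · exact hEXN.trans (union_subset hXA h)
    -- If N lay in B it would be closed as well as open, hence the whole sphere, yet it omits ∞.
    · have hNB : N = E ∩ B := by
        refine subset_antisymm (subset_inter hNE h) ?_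
        rintro y ⟨hy, hyB⟩
        exact (hEXN hy).resolve_left fun hyX => hd y (hXA hyX) hyB
      have hcl : IsClopen N := ⟨hNB ▸ hEcl.inter hB, hNo⟩
      have : OnePoint.infty ∈ N := by
        rw [hcl.eq_univ hNc.nonempty]
        exact mem_univ _
      exact absurd this (infty_notMem_toSphere _)
  rw [isPreconnected_iff_subset_of_fully_disjoint_closed hEcl]
  intro A B hA hB hAB hdis
  rcases hAB (infty_notMem_toSphere _) with h | h
  · exact Or.inl (main A B hA hB hAB hdis h)
  · exact Or.inr (main B A hB hA (union_comm A B ▸ hAB) hdis.symm h)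

/-! ### Disc automorphisms, disc charts and the Riemann mapping theorem. -/

open Metric ComplexConjugate

/-- The involutive automorphism of the unit disc exchanging `0` and `a`. -/
noncomputable def discAut (a z : ℂ) : ℂ := (a - z) / (1 - conj a * z)

theorem one_sub_conj_mul_ne_zero {a z : ℂ} (ha : ‖a‖ < 1) (hz : ‖z‖ < 1) :
    1 - conj a * z ≠ 0 := by
  intro h
  have h1 : ‖conj a * z‖ = 1 := by rw [← sub_eq_zero.1 h, norm_one]
  rw [norm_mul, RCLike.norm_conj] at h1
  nlinarith [norm_nonneg a, norm_nonneg z]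

theorem discAut_zero (a : ℂ) : discAut a 0 = a := by simp [discAut]

theorem discAut_self (a : ℂ) : discAut a a = 0 := by simp [discAut]

theorem one_sub_norm_discAut_sq {a z : ℂ} (ha : ‖a‖ < 1) (hz : ‖z‖ < 1) :
    1 - ‖discAut a z‖ ^ 2 = (1 - ‖a‖ ^ 2) * (1 - ‖z‖ ^ 2) / ‖1 - conj a * z‖ ^ 2 := by
  have h := norm_ne_zero_iff.2 (one_sub_conj_mul_ne_zero ha hz)
  rw [discAut, norm_div, div_pow, eq_div_iff (pow_ne_zero 2 h), sub_mul,
    div_mul_cancel₀ _ (pow_ne_zero 2 h)]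
  simp only [Complex.sq_norm, Complex.normSq_apply, Complex.sub_re, Complex.sub_im, Complex.one_re,
    Complex.one_im, Complex.mul_re, Complex.mul_im, Complex.conj_re, Complex.conj_im]
  ring

theorem one_sub_norm_discAut_sq_ge {a z : ℂ} (ha : ‖a‖ < 1) (hz : ‖z‖ < 1) :
    (1 - ‖a‖ ^ 2) * (1 - ‖z‖ ^ 2) / 4 ≤ 1 - ‖discAut a z‖ ^ 2 := by
  rw [one_sub_norm_discAut_sq ha hz]
  have h := norm_pos_iff.2 (one_sub_conj_mul_ne_zero ha hz)
  have h2 : ‖1 - conj a * z‖ ≤ 2 := by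
    refine (norm_sub_le _ _).trans ?_
    rw [norm_one, norm_mul, RCLike.norm_conj]
    nlinarith [norm_nonneg a, norm_nonneg z]
  refine div_le_div_of_nonneg_left ?_ (by positivity) (by nlinarith)
  exact mul_nonneg (by nlinarith [norm_nonneg a]) (by nlinarith [norm_nonneg z])

theorem norm_discAut_lt_one {a z : ℂ} (ha : ‖a‖ < 1) (hz : ‖z‖ < 1) : ‖discAut a z‖ < 1 := by
  have h := one_sub_norm_discAut_sq_ge ha hz
  have : 0 < (1 - ‖a‖ ^ 2) * (1 - ‖z‖ ^ 2) :=
    mul_pos (by nlinarith [norm_nonneg a]) (by nlinarith [norm_nonneg z])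
  nlinarith [norm_nonneg (discAut a z)]

theorem mapsTo_discAut {a : ℂ} (ha : ‖a‖ < 1) : MapsTo (discAut a) (ball 0 1) (ball 0 1) :=
  fun _ hz => mem_ball_zero_iff.2 (norm_discAut_lt_one ha (mem_ball_zero_iff.1 hz))

theorem discAut_discAut {a z : ℂ} (ha : ‖a‖ < 1) (hz : ‖z‖ < 1) :
    discAut a (discAut a z) = z := by
  have h1 := one_sub_conj_mul_ne_zero ha hz
  have h2 := one_sub_conj_mul_ne_zero ha ha
  have h3 := one_sub_conj_mul_ne_zero ha (norm_discAut_lt_one ha hz)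
  rw [discAut, div_eq_iff h3, discAut, ← sub_eq_zero]
  have h4 : (a - z) / (1 - conj a * z) * (1 - conj a * z) = a - z := div_mul_cancel₀ _ h1
  apply mul_right_cancel₀ h1
  linear_combination (conj a * z - 1) * h4

theorem differentiableOn_discAut {a : ℂ} (ha : ‖a‖ < 1) :
    DifferentiableOn ℂ (discAut a) (ball 0 1) := by
  unfold discAut
  exact DifferentiableOn.div (by fun_prop) (by fun_prop) fun z hz =>
    one_sub_conj_mul_ne_zero ha (mem_ball_zero_iff.1 hz)

theorem HasConnectedCompl.image_discAut {U : Set ℂ} (hU : HasConnectedCompl U)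
    (hUb : U ⊆ ball 0 1) {a : ℂ} (ha : ‖a‖ < 1) : HasConnectedCompl (discAut a '' U) := by
  have h := one_sub_conj_mul_ne_zero ha ha
  have := hU.image_mobius (a := -1) (b := a) (c := -conj a) (d := 1)
    (by intro h'; apply h; linear_combination -h') (fun z hz => by
      have := one_sub_conj_mul_ne_zero ha (mem_ball_zero_iff.1 (hUb hz))
      intro h'; apply this; linear_combination h')
  convert this using 3
  rw [discAut]
  congr 1 <;> ring

/-- An injective holomorphic map `g` from `U` to the unit disc, whose inverse extends to a
holomorphic self-map `G` of the disc. -/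
structure IsDiscChart (U : Set ℂ) (g G : ℂ → ℂ) : Prop where
  diff : DifferentiableOn ℂ g U
  mapsTo : MapsTo g U (ball 0 1)
  -- Having G on the whole disc allows estimates at points not yet known to lie in the image of g.
  inv_diff : DifferentiableOn ℂ G (ball 0 1)
  inv_mapsTo : MapsTo G (ball 0 1) (ball 0 1)
  left_inv : ∀ z ∈ U, G (g z) = z
  image : HasConnectedCompl (g '' U)

theorem IsDiscChart.comp {U : Set ℂ} {g G g' G' : ℂ → ℂ} (h : IsDiscChart U g G)
    (h' : IsDiscChart (g '' U) g' G') : IsDiscChart U (g' ∘ g) (G ∘ G') where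
  diff := h'.diff.comp h.diff (mapsTo_image g U)
  mapsTo := h'.mapsTo.comp (mapsTo_image g U)
  inv_diff := h.inv_diff.comp h'.inv_diff h'.inv_mapsTo
  inv_mapsTo := h.inv_mapsTo.comp h'.inv_mapsTo
  left_inv z hz := by
    rw [Function.comp_apply, Function.comp_apply, h'.left_inv _ (mem_image_of_mem g hz),
      h.left_inv z hz]
  image := by
    rw [image_comp]
    exact h'.image

theorem HasConnectedCompl.isDiscChart_discAut {U : Set ℂ} (hU : HasConnectedCompl U)
    (hUb : U ⊆ ball 0 1) {a : ℂ} (ha : ‖a‖ < 1) : IsDiscChart U (discAut a) (discAut a) where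
  diff := (differentiableOn_discAut ha).mono hUb
  mapsTo := (mapsTo_discAut ha).mono_left hUb
  inv_diff := differentiableOn_discAut ha
  inv_mapsTo := mapsTo_discAut ha
  left_inv _ hz := discAut_discAut ha (mem_ball_zero_iff.1 (hUb hz))
  image := hU.image_discAut hUb ha

/-- With u = φ_b(w), where φ_b is `discAut b`, the map factors as -φ_b(u) φ_{-b}(u) = -w φ_{-b}(u).
Two applications of `one_sub_norm_discAut_sq_ge` bound the second factor away from 1, giving 16 = 4
· 4 and (1 - |b|²)² = (1 - |a|)². -/
theorem norm_discAut_sq_comp_le {a b w : ℂ} (hb : ‖b‖ < 1) (hw : ‖w‖ < 1) (hab : b ^ 2 = a) :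
    ‖discAut a (discAut b w ^ 2)‖ ^ 2 ≤
      ‖w‖ ^ 2 * (1 - (1 - ‖a‖) ^ 2 * (1 - ‖w‖ ^ 2) / 16) := by
  subst hab
  set u := discAut b w with hu
  have hu1 : ‖u‖ < 1 := norm_discAut_lt_one hb hw
  have hb' : ‖-b‖ < 1 := by rwa [norm_neg]
  have h1 := one_sub_conj_mul_ne_zero hb hu1
  have h2 := one_sub_conj_mul_ne_zero hb' hu1
  have key : discAut (b ^ 2) (u ^ 2) = -(discAut b u * discAut (-b) u) := by
    have h3 : 1 - conj (b ^ 2) * u ^ 2 = (1 - conj b * u) * (1 - conj (-b) * u) := by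
      rw [map_pow, map_neg]; ring
    rw [discAut, discAut, discAut, h3, div_mul_div_comm, ← neg_div]
    congr 1
    ring
  rw [key, hu, discAut_discAut hb hw, ← hu, norm_neg, norm_mul, mul_pow]
  have e1 := one_sub_norm_discAut_sq_ge hb' hu1
  have e2 := one_sub_norm_discAut_sq_ge hb hw
  rw [norm_neg] at e1
  rw [norm_pow]
  refine mul_le_mul_of_nonneg_left ?_ (sq_nonneg _)
  have h4 : 0 ≤ 1 - ‖b‖ ^ 2 := by nlinarith [norm_nonneg b]
  have := mul_le_mul_of_nonneg_left e2 h4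
  nlinarith

/-- The square root map in the proof of the Riemann mapping theorem. -/
theorem HasConnectedCompl.exists_sqrt_discChart {U : Set ℂ} (hU : HasConnectedCompl U)
    (hUb : U ⊆ ball 0 1) (h0 : (0 : ℂ) ∈ U) {a : ℂ} (ha : ‖a‖ < 1) (haU : a ∉ U) :
    ∃ g G : ℂ → ℂ, IsDiscChart U g G ∧ g 0 = 0 ∧
      (∀ w : ℂ, ‖w‖ < 1 → ‖G w‖ ^ 2 ≤ ‖w‖ ^ 2 * (1 - (1 - ‖a‖) ^ 2 * (1 - ‖w‖ ^ 2) / 16)) ∧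
      ∀ r ≤ 1, (∀ w ∈ ball (0 : ℂ) r, G w ∈ U) → ball 0 r ⊆ g '' U := by
  have hφ := hU.isDiscChart_discAut hUb ha
  have h0U : (0 : ℂ) ∉ discAut a '' U := by
    rintro ⟨z, hz, h⟩
    have := hφ.left_inv z hz
    rw [h, discAut_zero] at this
    exact haU (this ▸ hz)
  obtain ⟨L, hL, hexp⟩ := hφ.image.exists_log_sub h0U
  set s : ℂ → ℂ := fun z => Complex.exp (L z / 2) with hs
  have hsd : DifferentiableOn ℂ s (discAut a '' U) := (hL.div_const 2).cexp
  have hsq : ∀ z ∈ discAut a '' U, s z ^ 2 = z := fun z hz => by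
    rw [hs, ← Complex.exp_nat_mul, Nat.cast_two, mul_div_cancel₀ _ two_ne_zero, hexp z hz, sub_zero]
  have hsb : MapsTo s (discAut a '' U) (ball 0 1) := fun z hz => by
    have h1 : ‖z‖ < 1 := mem_ball_zero_iff.1 (image_subset_iff.2 hφ.mapsTo hz)
    rw [← hsq z hz, norm_pow] at h1
    exact mem_ball_zero_iff.2 (by nlinarith [norm_nonneg (s z)])
  have hpow : MapsTo (fun w : ℂ => w ^ 2) (ball 0 1) (ball 0 1) := fun w hw => by
    rw [mem_ball_zero_iff] at hw ⊢
    rw [norm_pow]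
    nlinarith [norm_nonneg w]
  have hsc : IsDiscChart (discAut a '' U) s (fun w => w ^ 2) :=
    ⟨hsd, hsb, by fun_prop, hpow, hsq, hφ.image.image_sqrt h0U hsd.continuousOn hsq⟩
  have haI : a ∈ discAut a '' U := ⟨0, h0, discAut_zero a⟩
  have hb : ‖s a‖ < 1 := mem_ball_zero_iff.1 (hsb haI)
  have hψ := hsc.image.isDiscChart_discAut (image_subset_iff.2 hsb) hb
  refine ⟨_, _, hφ.comp (hsc.comp hψ), ?_, fun w hw => ?_, ?_⟩
  · simp only [Function.comp_apply, discAut_zero, discAut_self]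
  · exact norm_discAut_sq_comp_le hb hw (hsq a haI)
  · intro r hr hG w₀ hw₀
    have hball : ball (0 : ℂ) r ⊆ ball 0 1 := ball_subset_ball hr
    have hmem : ∀ w ∈ ball (0 : ℂ) r, discAut (s a) w ^ 2 ∈ discAut a '' U := fun w hw =>
      ⟨_, hG w hw, discAut_discAut ha
        (mem_ball_zero_iff.1 (hpow (mapsTo_discAut hb (hball hw))))⟩
    have hr0 : (0 : ℂ) ∈ ball (0 : ℂ) r := mem_ball_self (pos_of_mem_ball hw₀)
    have hc : ContinuousOn (discAut (s a)) (ball 0 r) :=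
      (differentiableOn_discAut hb).continuousOn.mono hball
    -- Both sides are continuous square roots of the same nonvanishing function on a ball, and they
    -- agree at 0.
    have heq : EqOn (fun w => s (discAut (s a) w ^ 2)) (discAut (s a)) (ball 0 r) := by
      refine isPreconnected_ball.eq_of_sq_eq (hsd.continuousOn.comp (hc.pow 2) hmem) hc
        (fun w hw => hsq _ (hmem w hw)) (fun {w} hw h => h0U ?_) hr0 ?_
      · simpa [h] using hmem w hw
      · simp only [discAut_zero, hsq a haI]
    refine ⟨_, hG w₀ hw₀, ?_⟩
    have h1 := heq hw₀
    simp only [Function.comp_apply] at h1 ⊢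
    rw [discAut_discAut ha (mem_ball_zero_iff.1 (hpow (mapsTo_discAut hb (hball hw₀)))), h1,
      discAut_discAut hb (mem_ball_zero_iff.1 (hball hw₀))]

/-- A form of the Riemann mapping theorem: `U` is mapped onto sets exhausting the disc. -/
theorem HasConnectedCompl.exists_discChart_ball_subset {U : Set ℂ} (hU : HasConnectedCompl U)
    (hUb : U ⊆ ball 0 1) {ζ : ℂ} (hζ : ζ ∈ U) {r : ℝ} (hr : r < 1) :
    ∃ g G : ℂ → ℂ, IsDiscChart U g G ∧ g ζ = 0 ∧ ball 0 r ⊆ g '' U := by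
  set S : Set ℝ := {r | r ≤ 1 ∧ ∃ g G : ℂ → ℂ, IsDiscChart U g G ∧ g ζ = 0 ∧ ball 0 r ⊆ g '' U}
    with hS
  have hφ := hU.isDiscChart_discAut hUb (mem_ball_zero_iff.1 (hUb hζ))
  have hbdd : BddAbove S := ⟨1, fun x hx => hx.1⟩
  obtain ⟨r₀, hr₀, hr₀S⟩ : ∃ r₀ > 0, r₀ ∈ S := by
    obtain ⟨ε, hε, hεU⟩ := Metric.isOpen_iff.1 hφ.image.isOpen 0 ⟨ζ, hζ, discAut_self ζ⟩
    exact ⟨min ε 1, lt_min hε one_pos, min_le_right _ _, _, _, hφ, discAut_self ζ,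
      (ball_subset_ball (min_le_left _ _)).trans hεU⟩
  -- If the supremum R were below 1, every chart would miss a point a with |a| < R₁. The square root
  -- step at a would then turn a covered radius x into min(R₁, x/q), forcing x ≤ Rq for all x in S,
  -- so R ≤ Rq with q < 1.
  have hR : 1 ≤ sSup S := by
    by_contra! hlt
    set R := sSup S
    have hR0 : 0 < R := hr₀.trans_le (le_csSup hbdd hr₀S)
    set R₁ := (1 + R) / 2 with hR₁
    set κ := (1 - R₁) ^ 2 * (1 - R₁ ^ 2) / 16 with hκ
    have hRR₁ : R < R₁ := by rw [hR₁]; linarith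
    have hR₁1 : R₁ < 1 := by rw [hR₁]; linarith
    have hκ0 : 0 < κ := div_pos (mul_pos (pow_pos (by linarith) 2) (by nlinarith)) (by norm_num)
    have hκ1 : κ < 1 := by
      have e1 : (1 - R₁) ^ 2 ≤ 1 := by nlinarith
      have e2 : 1 - R₁ ^ 2 ≤ 1 := by nlinarith
      have := mul_le_one₀ e1 (by nlinarith : 0 ≤ 1 - R₁ ^ 2) e2
      linarith
    set q := Real.sqrt (1 - κ) with hq
    have hq0 : 0 < q := Real.sqrt_pos.2 (by linarith)
    have hq2 : q ^ 2 = 1 - κ := Real.sq_sqrt (by linarith)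
    have hq1 : q < 1 := by nlinarith
    have step : ∀ x ∈ S, x ≤ R * q := by
      rintro x ⟨hx1, g, G, hg, hgζ, hxg⟩
      rcases le_or_gt x 0 with hx0 | hx0
      · exact hx0.trans (mul_pos hR0 hq0).le
      by_contra! hxR
      have hnot : ¬ ball (0 : ℂ) R₁ ⊆ g '' U := fun h =>
        absurd (le_csSup hbdd (⟨hR₁1.le, g, G, hg, hgζ, h⟩ : R₁ ∈ S)) (not_le.2 hRR₁)
      obtain ⟨a, ha, haU⟩ := not_subset.1 hnot
      rw [mem_ball_zero_iff] at ha
      obtain ⟨g', G', hg', hg'0, hest, hball⟩ := hg.image.exists_sqrt_discChart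
        (image_subset_iff.2 hg.mapsTo) ⟨ζ, hζ, hgζ⟩ (ha.trans hR₁1) haU
      set y := min R₁ (x / q) with hy
      have hyR : R < y := lt_min hRR₁ ((lt_div_iff₀ hq0).2 hxR)
      have hy1 : y ≤ 1 := (min_le_left _ _).trans hR₁1.le
      refine absurd (le_csSup hbdd (⟨hy1, _, _, hg.comp hg', ?_, ?_⟩ : y ∈ S)) (not_le.2 hyR)
      · rw [Function.comp_apply, hgζ, hg'0]
      · rw [image_comp]
        refine hball y hy1 fun w hw => hxg ?_
        rw [mem_ball_zero_iff] at hw ⊢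
        have hwR : ‖w‖ < R₁ := hw.trans_le (min_le_left _ _)
        have hwx : ‖w‖ * q < x := (lt_div_iff₀ hq0).1 (hw.trans_le (min_le_right _ _))
        have h1 : κ ≤ (1 - ‖a‖) ^ 2 * (1 - ‖w‖ ^ 2) / 16 := by
          rw [hκ]
          have e1 : (1 - R₁) ^ 2 ≤ (1 - ‖a‖) ^ 2 := pow_le_pow_left₀ (by linarith) (by linarith) 2
          have e2 : 1 - R₁ ^ 2 ≤ 1 - ‖w‖ ^ 2 := by nlinarith [norm_nonneg w]
          have := mul_le_mul e1 e2 (by nlinarith) (sq_nonneg _)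
          linarith
        have h2 : ‖G' w‖ ^ 2 ≤ (‖w‖ * q) ^ 2 := by
          rw [mul_pow, hq2]
          exact (hest w (hwR.trans hR₁1)).trans
            (mul_le_mul_of_nonneg_left (by linarith) (sq_nonneg _))
        exact (abs_le_of_sq_le_sq' h2 (by positivity)).2.trans_lt hwx
    have : R ≤ R * q := csSup_le ⟨r₀, hr₀S⟩ step
    nlinarith
  obtain ⟨x, ⟨-, g, G, h1, h2, h3⟩, hx⟩ := exists_lt_of_lt_csSup ⟨r₀, hr₀S⟩ (hr.trans_le hR)
  exact ⟨g, G, h1, h2, (ball_subset_ball hx.le).trans h3⟩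

/-! ### Harnack's inequality and charts near a puncture. -/

/-- Harnack's inequality for the real part of a holomorphic function. -/
theorem harnack_re {v : ℂ → ℂ} {ρ : ℝ} (hv : DifferentiableOn ℂ v (ball 0 ρ))
    (hpos : ∀ z ∈ ball (0 : ℂ) ρ, 0 < (v z).re) {w : ℂ} (hw : w ∈ ball (0 : ℂ) ρ) :
    (v 0).re * (ρ - ‖w‖) ≤ (v w).re * (ρ + ‖w‖) := by
  have hρ : 0 < ρ := pos_of_mem_ball hw
  have h0 := hpos 0 (mem_ball_self hρ)
  have hne : ∀ z ∈ ball (0 : ℂ) ρ, v z + conj (v 0) ≠ 0 := fun z hz h => by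
    have := congrArg Complex.re h
    simp only [Complex.add_re, Complex.conj_re, Complex.zero_re] at this
    linarith [hpos z hz]
  -- The Cayley transform centred at v(0) takes the right half-plane to the disc, so the Schwarz
  -- lemma applies.
  have hmaps : MapsTo (fun z => (v z - v 0) / (v z + conj (v 0))) (ball 0 ρ)
      (ball ((v 0 - v 0) / (v 0 + conj (v 0))) 1) := fun z hz => by
    rw [sub_self, zero_div, mem_ball_zero_iff, norm_div, div_lt_one (norm_pos_iff.2 (hne z hz))]
    refine lt_of_pow_lt_pow_left₀ 2 (norm_nonneg _) ?_
    simp only [Complex.sq_norm, Complex.normSq_apply, Complex.sub_re, Complex.sub_im,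
      Complex.add_re, Complex.add_im, Complex.conj_re, Complex.conj_im]
    nlinarith [mul_pos (hpos z hz) h0]
  have hs := Complex.dist_le_div_mul_dist_of_mapsTo_ball
    ((hv.sub_const (v 0)).div (hv.add_const _) hne) (hmaps.mono_right ball_subset_closedBall) hw
  simp only [sub_self, zero_div, dist_zero_right, Pi.div_apply, norm_div] at hs
  rw [div_le_iff₀ (norm_pos_iff.2 (hne w hw)), one_div_mul_eq_div, div_mul_eq_mul_div,
    le_div_iff₀ hρ] at hs
  have hwρ := mem_ball_zero_iff.1 hw
  have h1 := pow_le_pow_left₀ (by positivity) hs 2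
  rw [mul_pow, mul_pow] at h1
  simp only [Complex.sq_norm (_ - _), Complex.sq_norm (_ + _), Complex.normSq_apply,
    Complex.sub_re, Complex.sub_im,
    Complex.add_re, Complex.add_im, Complex.conj_re, Complex.conj_im] at h1
  have h2 : (((v 0).re - (v w).re) * ρ) ^ 2 ≤ (‖w‖ * ((v w).re + (v 0).re)) ^ 2 := by
    have h3 : 0 ≤ (ρ ^ 2 - ‖w‖ ^ 2) * ((v w).im - (v 0).im) ^ 2 :=
      mul_nonneg (by nlinarith [norm_nonneg w]) (sq_nonneg _)
    nlinarith
  have h4 := (abs_le_of_sq_le_sq' h2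
    (mul_nonneg (norm_nonneg w) (add_pos (hpos w hw) h0).le)).2
  linarith

/-- If `U` is a subdomain of the punctured disc and `ζ ∈ U` is close to `0`, then `U` has a chart
centred at `ζ` for which almost the whole disc corresponds to points near `0`. -/
theorem HasConnectedCompl.exists_discChart_near_zero {U : Set ℂ} (hU : HasConnectedCompl U)
    (hUb : U ⊆ ball 0 1) (h0 : (0 : ℂ) ∉ U) {m r : ℝ} (hm : 0 < m) (hr : r < 1) :
    ∃ δ > 0, ∀ ζ ∈ U, ‖ζ‖ < δ → ∃ g G : ℂ → ℂ, IsDiscChart U g G ∧ g ζ = 0 ∧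
      ball 0 r ⊆ g '' (U ∩ ball 0 m) := by
  obtain ⟨L, hL, hexp⟩ := hU.exists_log_sub h0
  set R := max r 0 with hR
  set ρ := (1 + R) / 2 with hρ
  have hR1 : R < 1 := max_lt hr one_pos
  have hR0 : 0 ≤ R := le_max_right _ _
  have hRρ : R < ρ := by rw [hρ]; linarith
  have hρ1 : ρ < 1 := by rw [hρ]; linarith
  set c := (ρ - R) / (ρ + R) with hc
  have hc0 : 0 < c := div_pos (by linarith) (by linarith)
  -- Harnack on the disc of radius ρ gives log|G w| ≤ c log|ζ| for |w| < R, so |ζ| < m^(1/c)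
  -- suffices.
  refine ⟨Real.exp (Real.log m / c), Real.exp_pos _, fun ζ hζ hζδ => ?_⟩
  obtain ⟨g, G, hg, hgζ, hball⟩ := hU.exists_discChart_ball_subset hUb hζ hρ1
  refine ⟨g, G, hg, hgζ, fun w hw => ?_⟩
  have hwR : ‖w‖ < R := (mem_ball_zero_iff.1 hw).trans_le (le_max_left _ _)
  have hwρ : w ∈ ball (0 : ℂ) ρ := mem_ball_zero_iff.2 (hwR.trans hRρ)
  have hGU : MapsTo G (ball 0 ρ) U := fun w hw => by
    obtain ⟨z, hz, rfl⟩ := hball hw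
    rwa [hg.left_inv z hz]
  obtain ⟨z, hz, hzw⟩ := hball hwρ
  refine ⟨z, ⟨hz, ?_⟩, hzw⟩
  have hnorm : ∀ z ∈ U, ‖z‖ = Real.exp (L z).re := fun z hz => by
    rw [← Complex.norm_exp, hexp z hz, sub_zero]
  have hre : ∀ z ∈ U, (L z).re < 0 := fun z hz => by
    have := mem_ball_zero_iff.1 (hUb hz)
    rwa [hnorm z hz, Real.exp_lt_one_iff] at this
  have hG0 : G 0 = ζ := by rw [← hgζ, hg.left_inv ζ hζ]
  have hGw : G w = z := by rw [← hzw, hg.left_inv z hz]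
  have key := harnack_re (v := fun w => -L (G w))
    (hL.comp (hg.inv_diff.mono (ball_subset_ball hρ1.le)) hGU).neg (fun w hw => by
      simpa using hre _ (hGU hw)) hwρ
  simp only [hG0, hGw, Complex.neg_re] at key
  have h1 : (L ζ).re < Real.log m / c := by rwa [hnorm ζ hζ, Real.exp_lt_exp] at hζδ
  rw [lt_div_iff₀ hc0] at h1
  have h2 : (L z).re ≤ (L ζ).re * c := by
    rw [hc, ← mul_div_assoc, le_div_iff₀ (by linarith)]
    have e1 : (L ζ).re * (ρ - ‖w‖) ≤ (L ζ).re * (ρ - R) :=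
      mul_le_mul_of_nonpos_left (by linarith) (hre ζ hζ).le
    have e2 : (L z).re * (ρ + R) ≤ (L z).re * (ρ + ‖w‖) :=
      mul_le_mul_of_nonpos_left (by linarith) (hre z hz).le
    linarith
  rw [mem_ball_zero_iff, hnorm z hz, ← Real.lt_log_iff_exp_lt hm]
  exact h2.trans_lt h1

/-- A plane domain with connected complement omitting `0` embeds in the punctured disc so
that `∞` corresponds to `0`. -/
theorem HasConnectedCompl.exists_embedding_punctured_disc {Ω : Set ℂ} (hΩ : HasConnectedCompl Ω)
    (h0 : (0 : ℂ) ∉ Ω) : ∃ j : ℂ → ℂ, DifferentiableOn ℂ j Ω ∧ InjOn j Ω ∧ j '' Ω ⊆ ball 0 1 ∧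
      (0 : ℂ) ∉ j '' Ω ∧ HasConnectedCompl (j '' Ω) ∧
      (∀ δ > 0, ∃ M : ℝ, ∀ z ∈ Ω, M < ‖z‖ → ‖j z‖ < δ) ∧
      ∀ M : ℝ, ∃ m > 0, ∀ z ∈ Ω, ‖z‖ ≤ M → m ≤ ‖j z‖ := by
  obtain ⟨L, hL, hexp⟩ := hΩ.exists_log_sub h0
  set s : ℂ → ℂ := fun z => Complex.exp (L z / 2) with hs
  have hsd : DifferentiableOn ℂ s Ω := (hL.div_const 2).cexp
  have hsq : ∀ z ∈ Ω, s z ^ 2 = z := fun z hz => by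
    rw [hs, ← Complex.exp_nat_mul, Nat.cast_two, mul_div_cancel₀ _ two_ne_zero, hexp z hz, sub_zero]
  have hs0 : ∀ z, s z ≠ 0 := fun z => Complex.exp_ne_zero _
  have hinj : InjOn s Ω := fun z hz w hw h => by rw [← hsq z hz, h, hsq w hw]
  have hsΩ := hΩ.image_sqrt h0 hsd.continuousOn hsq
  obtain ⟨z₀, hz₀⟩ := hΩ.isConnected.nonempty
  obtain ⟨ρ, hρ, hball⟩ := Metric.isOpen_iff.1 hsΩ.isOpen (s z₀) (mem_image_of_mem s hz₀)
  -- The branch s(Ω) contains a ball about s(z₀) and is disjoint from -s(Ω), so -s(z) stays at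
  -- distance at least ρ from s(z₀).
  have hfar : ∀ z ∈ Ω, ρ ≤ ‖s z + s z₀‖ := fun z hz => by
    by_contra! h
    obtain ⟨w, hw, hws⟩ := hball (show -s z ∈ ball (s z₀) ρ by
      rwa [mem_ball_iff_norm, ← neg_add', norm_neg])
    have : w = z := by rw [← hsq w hw, hws, neg_sq, hsq z hz]
    subst this
    exact hs0 w (self_eq_neg.1 hws)
  have hne : ∀ z ∈ Ω, s z + s z₀ ≠ 0 := fun z hz => norm_pos_iff.1 (hρ.trans_le (hfar z hz))
  have hρ2 : ((ρ / 2 : ℝ) : ℂ) ≠ 0 := Complex.ofReal_ne_zero.2 (half_pos hρ).ne'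
  have hnorm : ∀ z, ‖((ρ / 2 : ℝ) : ℂ) / (s z + s z₀)‖ = ρ / 2 / ‖s z + s z₀‖ := fun z => by
    rw [norm_div, Complex.norm_real, Real.norm_of_nonneg (half_pos hρ).le]
  refine ⟨fun z => ((ρ / 2 : ℝ) : ℂ) / (s z + s z₀),
    (differentiableOn_const _).div (hsd.add_const _) hne, ?_, ?_, ?_, ?_, ?_, ?_⟩
  · intro z hz w hw h
    have := mul_left_cancel₀ hρ2 ((div_eq_div_iff (hne z hz) (hne w hw)).1 h)
    exact hinj hz hw (add_right_cancel this.symm)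
  · rintro _ ⟨z, hz, rfl⟩
    rw [mem_ball_zero_iff, hnorm, div_lt_one (hρ.trans_le (hfar z hz))]
    exact (half_lt_self hρ).trans_le (hfar z hz)
  · rintro ⟨z, hz, h⟩
    exact div_ne_zero hρ2 (hne z hz) h
  · have := hsΩ.image_mobius (a := 0) (b := ((ρ / 2 : ℝ) : ℂ)) (c := 1) (d := s z₀)
      (by simpa using hρ.ne') (by rintro _ ⟨z, hz, rfl⟩; simpa using hne z hz)
    rw [image_image] at this
    simpa using this
  · intro δ hδ
    refine ⟨(ρ / 2 / δ + ‖s z₀‖) ^ 2, fun z hz hM => ?_⟩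
    have h1 : ρ / 2 / δ + ‖s z₀‖ < ‖s z‖ := by
      rw [← hsq z hz, norm_pow] at hM
      exact lt_of_pow_lt_pow_left₀ 2 (norm_nonneg _) hM
    rw [hnorm, div_lt_iff₀ (hρ.trans_le (hfar z hz)), mul_comm, ← div_lt_iff₀ hδ]
    have := norm_sub_le (s z + s z₀) (s z₀)
    rw [add_sub_cancel_right] at this
    linarith
  · intro M
    have hpos : 0 < |M| + 1 + ‖s z₀‖ := by positivity
    refine ⟨ρ / 2 / (|M| + 1 + ‖s z₀‖), div_pos (half_pos hρ) hpos, fun z hz hM => ?_⟩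
    rw [hnorm]
    refine div_le_div_of_nonneg_left (half_pos hρ).le (hρ.trans_le (hfar z hz)) ?_
    have h1 : ‖s z‖ ≤ |M| + 1 := by
      rw [← hsq z hz, norm_pow] at hM
      nlinarith [le_abs_self M, abs_nonneg M, norm_nonneg (s z)]
    exact (norm_add_le _ _).trans (by linarith)

/-! ### Embeddings near a complementary component. -/

/-- A Möbius transformation with prescribed pole and zero. -/
theorem exists_mobius_pole_zero {p q : OnePoint ℂ} (hpq : q ≠ p) :
    ∃ (τ : OnePoint ℂ ≃ₜ OnePoint ℂ) (T : ℂ → ℂ), τ p = OnePoint.infty ∧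
      τ q = ((0 : ℂ) : OnePoint ℂ) ∧ ∀ z : ℂ, (z : OnePoint ℂ) ≠ p →
        τ z = ((T z : ℂ) : OnePoint ℂ) ∧ DifferentiableAt ℂ T z := by
  induction p using OnePoint.rec with
  | infty =>
    induction q using OnePoint.rec with
    | infty => exact absurd rfl hpq
    | coe q =>
      obtain ⟨τ, h1, -, -, h4⟩ := exists_sphere_mobius (a := 1) (b := -q) (c := 0) (d := 1) (by simp)
      refine ⟨τ, _, h4 rfl, ?_, fun z _ => ⟨h1 z (by simp), ?_⟩⟩
      · rw [h1 q (by simp)]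
        simp
      · fun_prop (disch := simp)
  | coe p =>
    induction q using OnePoint.rec with
    | infty =>
      obtain ⟨τ, h1, h2, h3, -⟩ :=
        exists_sphere_mobius (a := 0) (b := 1) (c := 1) (d := -p) (by simp)
      have hz : ∀ z : ℂ, (z : OnePoint ℂ) ≠ p → 1 * z + -p ≠ 0 := fun z hz h =>
        hz (congrArg _ (by linear_combination h))
      refine ⟨τ, _, h2 p (by simp), ?_, fun z hzp => ⟨h1 z (hz z hzp), ?_⟩⟩
      · rw [h3 one_ne_zero, zero_div]
      · exact DifferentiableAt.div (by fun_prop) (by fun_prop) (hz z hzp)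
    | coe q =>
      have hqp : q - p ≠ 0 := fun h => hpq (congrArg _ (sub_eq_zero.1 h))
      obtain ⟨τ, h1, h2, -, -⟩ :=
        exists_sphere_mobius (a := 1) (b := -q) (c := 1) (d := -p)
          (by intro h; apply hqp; linear_combination h)
      have hz : ∀ z : ℂ, (z : OnePoint ℂ) ≠ p → 1 * z + -p ≠ 0 := fun z hz h =>
        hz (congrArg _ (by linear_combination h))
      refine ⟨τ, _, h2 p (by simp), ?_, fun z hzp => ⟨h1 z (hz z hzp), ?_⟩⟩
      · rw [h1 q (hz q hpq)]
        simp
      · exact DifferentiableAt.div (by fun_prop) (by fun_prop) (hz z hzp)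

/-- Near a nondegenerate complementary component that is isolated from the others, a domain embeds
in the disc with image containing a large disc. -/
theorem eventually_exists_embedding {D : Set ℂ} (hD : IsDomainSet D) {p : OnePoint ℂ}
    (hp : p ∈ (toSphere D)ᶜ) (hnt : (connectedComponentIn (toSphere D)ᶜ p).Nontrivial)
    (hcl : IsClosed ((toSphere D)ᶜ \ connectedComponentIn (toSphere D)ᶜ p)) {r : ℝ} (hr : r < 1) :
    ∀ᶠ x in 𝓝 p, ∀ z ∈ D, (z : OnePoint ℂ) = x → ∃ f : ℂ → ℂ, DifferentiableOn ℂ f D ∧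
      InjOn f D ∧ MapsTo f D (ball 0 1) ∧ f z = 0 ∧ ball 0 r ⊆ f '' D := by
  set K := connectedComponentIn (toSphere D)ᶜ p with hK
  have hDo : IsOpen (toSphere D) := isOpen_toSphere.2 hD.1
  have hDc : IsConnected (toSphere D) := hD.2.image _ OnePoint.continuous_coe.continuousOn
  have hpK : p ∈ K := mem_connectedComponentIn hp
  have hKD : K ⊆ (toSphere D)ᶜ := connectedComponentIn_subset _ _
  have hKcl : IsClosed K := isClosed_connectedComponentIn hDo.isClosed_compl p
  obtain ⟨q, hqK, hqp⟩ := hnt.exists_ne p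
  obtain ⟨τ, T, hτp, hτq, hT⟩ := exists_mobius_pole_zero hqp
  set Ω : Set ℂ := {z | (z : OnePoint ℂ) ∈ τ '' Kᶜ} with hΩdef
  have hΩs : toSphere Ω = τ '' Kᶜ := by
    refine image_preimage_eq_of_subset ?_
    rintro _ ⟨x, hx, rfl⟩
    refine OnePoint.ne_infty_iff_exists.1 fun h => hx ?_
    rw [← hτp] at h
    exact τ.injective h ▸ hpK
  have hTD : MapsTo T D Ω := fun z hz => by
    have hzK : (z : OnePoint ℂ) ∉ K := fun h => hKD h (mem_image_of_mem _ hz)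
    exact ⟨z, hzK, (hT z fun h => hzK (h ▸ hpK)).1⟩
  have hDp : ∀ z ∈ D, (z : OnePoint ℂ) ≠ p := fun z hz h => hp (h ▸ mem_image_of_mem _ hz)
  have hΩ : HasConnectedCompl Ω := by
    refine ⟨?_, ⟨?_, ?_⟩, ?_⟩
    · rw [← isOpen_toSphere, hΩs]
      exact τ.isOpenMap _ hKcl.isOpen_compl
    · obtain ⟨z, hz⟩ := hD.2.nonempty
      exact ⟨T z, hTD hz⟩
    · rw [← OnePoint.isOpenEmbedding_coe.isInducing.isPreconnected_image]
      change IsPreconnected (toSphere Ω)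
      rw [hΩs]
      exact (isPreconnected_compl_connectedComponentIn hDo hDc hp).image _ τ.continuous.continuousOn
    · rw [hΩs, ← image_compl_eq τ.bijective, compl_compl]
      exact isPreconnected_connectedComponentIn.image _ τ.continuous.continuousOn
  have h0Ω : (0 : ℂ) ∉ Ω := by
    rintro ⟨x, hx, h⟩
    rw [← hτq] at h
    exact hx (τ.injective h ▸ hqK)
  obtain ⟨j, hjd, hjinj, hjb, hj0, hjc, hjsmall, hjbig⟩ := hΩ.exists_embedding_punctured_disc h0Ω
  -- The remaining components are closed and avoid p, so their images avoid a neighbourhood of ∞.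
  obtain ⟨M, hM⟩ : ∃ M : ℝ, ∀ z : ℂ, (z : OnePoint ℂ) ∈ τ '' ((toSphere D)ᶜ \ K) → ‖z‖ ≤ M := by
    have hcl' : IsClosed (τ '' ((toSphere D)ᶜ \ K)) := τ.isClosedMap _ hcl
    have hinf : OnePoint.infty ∉ τ '' ((toSphere D)ᶜ \ K) := by
      rintro ⟨x, hx, h⟩
      rw [← hτp] at h
      exact hx.2 (τ.injective h ▸ hpK)
    have h1 := tendsto_coe_cobounded.eventually (hcl'.isOpen_compl.mem_nhds hinf)
    have h2 : Bornology.IsBounded {z : ℂ | (z : OnePoint ℂ) ∈ τ '' ((toSphere D)ᶜ \ K)} := by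
      rw [Bornology.isBounded_def]
      exact h1
    exact h2.exists_norm_le
  obtain ⟨m, hm, hmM⟩ := hjbig M
  obtain ⟨δ, hδ, hchart⟩ := hjc.exists_discChart_near_zero hjb hj0 hm hr
  obtain ⟨M', hM'⟩ := hjsmall δ hδ
  have hnear : ∀ᶠ y in 𝓝 (OnePoint.infty : OnePoint ℂ), ∀ z : ℂ, (z : OnePoint ℂ) = y → M' < ‖z‖ := by
    rw [OnePoint.nhds_infty_eq, eventually_sup, eventually_map, coclosedCompact_eq_cocompact,
      ← Metric.cobounded_eq_cocompact]
    refine ⟨?_, eventually_pure.2 fun z hz => absurd hz (OnePoint.coe_ne_infty z)⟩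
    filter_upwards [tendsto_norm_cobounded_atTop.eventually_gt_atTop M'] with w hw z hz
    rwa [OnePoint.coe_injective hz]
  have hτ : Tendsto τ (𝓝 p) (𝓝 OnePoint.infty) := hτp ▸ τ.continuous.tendsto p
  filter_upwards [hτ.eventually hnear] with x hx z hz hzx
  subst hzx
  have hTinj : InjOn T D := fun a ha b hb h => by
    refine OnePoint.coe_injective (τ.injective ?_)
    rw [(hT a (hDp a ha)).1, (hT b (hDp b hb)).1, h]
  obtain ⟨g, G, hg, hg0, hball⟩ := hchart (j (T z)) (mem_image_of_mem j (hTD hz))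
    (hM' _ (hTD hz) (hx _ (hT z (hDp z hz)).1.symm))
  have hjT : MapsTo (j ∘ T) D (j '' Ω) := (mapsTo_image j Ω).comp hTD
  have hginj : InjOn g (j '' Ω) := fun a ha b hb h => by
    rw [← hg.left_inv a ha, h, hg.left_inv b hb]
  refine ⟨g ∘ j ∘ T, hg.diff.comp (hjd.comp
    (fun z hz => (hT z (hDp z hz)).2.differentiableWithinAt) hTD) hjT,
    hginj.comp (hjinj.comp hTinj hTD) hjT, hg.mapsTo.comp hjT, hg0, fun w hw => ?_⟩
  obtain ⟨_, ⟨⟨y, hy, rfl⟩, hyb⟩, rfl⟩ := hball hw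
  obtain ⟨x, hxK, hxy⟩ := id hy
  -- A point of Ω outside D belongs to another component, so j has modulus at least m there, whereas
  -- here it is less than m.
  have hxD : x ∈ toSphere D := by
    by_contra hxD
    have := hmM y hy (hM y ⟨x, ⟨hxD, hxK⟩, hxy⟩)
    exact absurd (mem_ball_zero_iff.1 hyb) (not_lt.2 this)
  obtain ⟨d, hd, rfl⟩ := hxD
  rw [(hT d (hDp d hd)).1] at hxy
  exact ⟨d, hd, by rw [Function.comp_apply, Function.comp_apply, OnePoint.coe_injective hxy]⟩

/-! ### Bounds on the squeezing function and finitely connected domains. -/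

theorem le_one_of_ball_subset_image {D : Set ℂ} {f : ℂ → ℂ} (hf : MapsTo f D (ball 0 1)) {r : ℝ}
    (hr : ball 0 r ⊆ f '' D) : r ≤ 1 := by
  by_contra! h
  obtain ⟨z, hz, hz1⟩ := hr (show ((1 : ℝ) : ℂ) ∈ ball (0 : ℂ) r by simpa using h)
  have := mem_ball_zero_iff.1 (hf hz)
  simp [hz1] at this

theorem squeezingRadius_le_one {D : Set ℂ} {f : ℂ → ℂ} (hf : MapsTo f D (ball 0 1)) :
    squeezingRadius D f ≤ 1 :=
  Real.sSup_le (fun _ hr => le_one_of_ball_subset_image hf hr.2) zero_le_one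

theorem squeezingFunction_le_one (D : Set ℂ) (p : ℂ) : squeezingFunction D p ≤ 1 := by
  refine Real.sSup_le ?_ zero_le_one
  rintro _ ⟨f, hf, rfl⟩
  exact squeezingRadius_le_one hf.mapsTo

theorem isOpen_image_of_injOn {D : Set ℂ} (hD : IsDomainSet D) {f : ℂ → ℂ}
    (hf : DifferentiableOn ℂ f D) (hinj : InjOn f D) {V : Set ℂ} (hVD : V ⊆ D) (hV : IsOpen V) :
    IsOpen (f '' V) := by
  rcases (hf.analyticOnNhd hD.1).is_constant_or_isOpen hD.2.isPreconnected with ⟨w, hw⟩ | h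
  · obtain ⟨z, hz⟩ := hD.2.nonempty
    have hsub : D ⊆ {z} := fun y hy => hinj hy hz (by rw [hw y hy, hw z hz])
    have : IsOpen ({z} : Set ℂ) := by
      rw [← hsub.antisymm (singleton_subset_iff.2 hz)]
      exact hD.1
    exact absurd this (not_isOpen_singleton z)
  · exact h V hVD hV

theorem isEmbeddingAt_of_injOn {D : Set ℂ} (hD : IsDomainSet D) {p : ℂ} {f : ℂ → ℂ}
    (hf : DifferentiableOn ℂ f D) (hinj : InjOn f D) (hmaps : MapsTo f D (ball 0 1))
    (hp : f p = 0) : IsEmbeddingAt D p f := by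
  refine ⟨hf, ?_, hmaps, hp⟩
  refine .of_continuous_injective_isOpenMap (hf.continuousOn.domRestrict)
    (injOn_iff_injective.1 hinj) fun V hV => ?_
  have : domRestrict D f '' V = f '' (Subtype.val '' V) := by
    rw [image_image]
    rfl
  rw [this]
  exact isOpen_image_of_injOn hD hf hinj (Subtype.coe_image_subset D V)
    (hD.1.isOpenMap_subtype_val V hV)

theorem le_squeezingFunction {D : Set ℂ} (hD : IsDomainSet D) {p : ℂ} {f : ℂ → ℂ}
    (hf : DifferentiableOn ℂ f D) (hinj : InjOn f D) (hmaps : MapsTo f D (ball 0 1))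
    (hp : f p = 0) {r : ℝ} (hr : 0 < r) (hball : ball 0 r ⊆ f '' D) :
    r ≤ squeezingFunction D p := by
  have h1 : r ≤ squeezingRadius D f :=
    le_csSup ⟨1, fun _ hx => le_one_of_ball_subset_image hmaps hx.2⟩ ⟨hr, hball⟩
  refine h1.trans (le_csSup ⟨1, ?_⟩ ⟨f, isEmbeddingAt_of_injOn hD hf hinj hmaps hp, rfl⟩)
  rintro _ ⟨f, hf, rfl⟩
  exact squeezingRadius_le_one hf.mapsTo

/-- The squeezing function is locally bounded below by a positive constant. -/
theorem eventually_le_squeezingFunction {D : Set ℂ} (hD : IsDomainSet D) {f : ℂ → ℂ}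
    (hf : DifferentiableOn ℂ f D) (hinj : InjOn f D) (hmaps : MapsTo f D (ball 0 1))
    {z₀ : ℂ} (hz₀ : z₀ ∈ D) : ∃ c > 0, ∀ᶠ z in 𝓝 z₀, c ≤ squeezingFunction D z := by
  obtain ⟨c, hc, hball⟩ := Metric.isOpen_iff.1 (isOpen_image_of_injOn hD hf hinj subset_rfl hD.1)
    (f z₀) (mem_image_of_mem f hz₀)
  have hcont : ContinuousAt f z₀ := hf.continuousOn.continuousAt (hD.1.mem_nhds hz₀)
  -- Translating by f(z) may double the size, hence the division by 2; the ball of radius c about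
  -- f(z₀) contains the one of radius c/2 about f(z), which shrinks to c/4.
  refine ⟨c / 4, by positivity, ?_⟩
  filter_upwards [hcont.eventually (ball_mem_nhds (f z₀) (half_pos hc)), hD.1.mem_nhds hz₀]
    with z hz hzD
  refine le_squeezingFunction hD (f := fun w => (f w - f z) / 2)
    ((hf.sub_const _).div_const 2) (fun x hx y hy h => hinj hx hy ?_) (fun w hw => ?_)
    (by rw [sub_self, zero_div]) (by positivity) (fun w hw => ?_)
  · exact sub_left_injective ((div_left_inj' two_ne_zero).1 h)
  · have h1 := mem_ball_zero_iff.1 (hmaps hw)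
    have h2 := mem_ball_zero_iff.1 (hmaps hzD)
    rw [mem_ball_zero_iff, norm_div, Complex.norm_two]
    linarith [norm_sub_le (f w) (f z)]
  · obtain ⟨y, hy, hyw⟩ := hball (show 2 * w + f z ∈ ball (f z₀) c by
      rw [mem_ball_zero_iff] at hw
      rw [dist_eq_norm] at hz
      rw [mem_ball_iff_norm, add_sub_assoc]
      refine (norm_add_le _ _).trans_lt ?_
      rw [norm_mul, Complex.norm_two]
      linarith)
    exact ⟨y, hy, by simp only [hyw]; ring⟩

theorem frontier_toSphere_nonempty {D : Set ℂ} (hD : IsDomainSet D) :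
    (frontier (toSphere D)).Nonempty := by
  rw [nonempty_iff_ne_empty, Ne, ← isClopen_iff_frontier_eq_empty, isClopen_iff, not_or]
  exact ⟨(hD.2.nonempty.image _).ne_empty, fun h => infty_notMem_toSphere D (h ▸ mem_univ _)⟩

theorem tendsto_and_isHolomorphicHomogeneousRegular {D : Set ℂ} (hD : IsDomainSet D)
    (hfin : (complementComponents D).Finite)
    (hnt : ∀ C ∈ complementComponents D, C.Nontrivial) :
    Tendsto (squeezingFunction D) (towardBoundary D) (𝓝 1) ∧
      IsHolomorphicHomogeneousRegular D := by
  have hDo : IsOpen (toSphere D) := isOpen_toSphere.2 hD.1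
  have hfront : ∀ p ∈ frontier (toSphere D), ∀ r < 1, ∀ᶠ x in 𝓝 p, ∀ z ∈ D,
      (z : OnePoint ℂ) = x → ∃ f : ℂ → ℂ, DifferentiableOn ℂ f D ∧
        InjOn f D ∧ MapsTo f D (ball 0 1) ∧ f z = 0 ∧ ball 0 r ⊆ f '' D := by
    intro p hp r hr
    have hpD : p ∈ (toSphere D)ᶜ := fun h => by
      rw [hDo.frontier_eq] at hp
      exact hp.2 h
    refine eventually_exists_embedding hD hpD (hnt _ ⟨p, hpD, rfl⟩) ?_ hr
    have heq : (toSphere D)ᶜ \ connectedComponentIn (toSphere D)ᶜ p =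
        ⋃ C ∈ complementComponents D \ {connectedComponentIn (toSphere D)ᶜ p}, C := by
      ext x
      simp only [mem_iUnion, exists_prop]
      constructor
      · rintro ⟨hx, hxp⟩
        refine ⟨_, ⟨⟨x, hx, rfl⟩, fun h => hxp ?_⟩, mem_connectedComponentIn hx⟩
        exact h ▸ mem_connectedComponentIn hx
      · rintro ⟨_, ⟨⟨y, hy, rfl⟩, hne⟩, hxy⟩
        refine ⟨connectedComponentIn_subset _ _ hxy, fun h => hne ?_⟩
        rw [mem_singleton_iff, connectedComponentIn_eq hxy, connectedComponentIn_eq h]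
    rw [heq]
    refine (hfin.subset sdiff_subset).isClosed_biUnion ?_
    rintro _ ⟨⟨y, hy, rfl⟩, -⟩
    exact isClosed_connectedComponentIn hDo.isClosed_compl y
  have hlow : ∀ p ∈ frontier (toSphere D), ∀ r < 1, 0 < r → ∀ᶠ x in 𝓝 p, ∀ z ∈ D,
      (z : OnePoint ℂ) = x → r ≤ squeezingFunction D z := by
    intro p hp r hr hr0
    filter_upwards [hfront p hp r hr] with x hx z hz hzx
    obtain ⟨f, hf, hinj, hmaps, hfz, hball⟩ := hx z hz hzx
    exact le_squeezingFunction hD hf hinj hmaps hfz hr0 hball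
  refine ⟨tendsto_order.2 ⟨fun a ha => ?_, fun a ha => .of_forall fun z =>
    (squeezingFunction_le_one D z).trans_lt ha⟩, hD, ?_⟩
  · rw [towardBoundary, eventually_inf_principal, eventually_comap]
    refine eventually_nhdsSet_iff_forall.2 fun p hp => ?_
    -- The maximum with 1/2 keeps the radius positive when a is negative.
    have h1 : max ((1 + a) / 2) (1 / 2) < 1 := max_lt (by linarith) (by norm_num)
    filter_upwards [hlow p hp _ h1 (lt_max_of_lt_right (by norm_num))] with x hx z hzx hz
    refine lt_of_lt_of_le ?_ (hx z hz hzx)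
    exact lt_max_of_lt_left (by linarith)
  · obtain ⟨p, hp⟩ := frontier_toSphere_nonempty hD
    obtain ⟨f, hf, hinj, hmaps⟩ : ∃ f : ℂ → ℂ, DifferentiableOn ℂ f D ∧ InjOn f D ∧
        MapsTo f D (ball 0 1) := by
      obtain ⟨x, ⟨z, hz, rfl⟩, hx⟩ := ((mem_closure_iff_frequently.1 (frontier_subset_closure hp)
        ).and_eventually (hfront p hp 0 one_pos)).exists
      obtain ⟨f, h1, h2, h3, -⟩ := hx z hz rfl
      exact ⟨f, h1, h2, h3⟩
    -- Cover the compact sphere: interior points use the local bound, boundary points the bound 1/2,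
    -- and exterior points have a neighbourhood missing D.
    have huniv : ∃ c > 0, ∀ z ∈ D, (z : OnePoint ℂ) ∈ (univ : Set (OnePoint ℂ)) →
        c ≤ squeezingFunction D z := by
      refine isCompact_univ.induction_on (p := fun S => ∃ c > 0, ∀ z ∈ D, (z : OnePoint ℂ) ∈ S →
        c ≤ squeezingFunction D z) ⟨1, one_pos, fun z _ h => absurd h (notMem_empty _)⟩ ?_ ?_ ?_
      · rintro S S' hS ⟨c, hc, h⟩
        exact ⟨c, hc, fun z hz hzS => h z hz (hS hzS)⟩
      · rintro S S' ⟨c, hc, h⟩ ⟨c', hc', h'⟩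
        refine ⟨min c c', lt_min hc hc', fun z hz hzS => ?_⟩
        rcases hzS with hzS | hzS
        · exact (min_le_left _ _).trans (h z hz hzS)
        · exact (min_le_right _ _).trans (h' z hz hzS)
      · intro x _
        rw [nhdsWithin_univ]
        by_cases hxD : x ∈ toSphere D
        · obtain ⟨z, hz, rfl⟩ := hxD
          obtain ⟨c, hc, h⟩ := eventually_le_squeezingFunction hD hf hinj hmaps hz
          refine ⟨_, OnePoint.isOpenMap_coe.image_mem_nhds h, c, hc, fun w _ hw => ?_⟩
          obtain ⟨w', hw', hww⟩ := hw
          rwa [← OnePoint.coe_injective hww]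
        · by_cases hxf : x ∈ frontier (toSphere D)
          · exact ⟨_, hlow x hxf (1 / 2) (by norm_num) (by norm_num), 1 / 2, by norm_num,
              fun z hz hzS => hzS z hz rfl⟩
          · refine ⟨(closure (toSphere D))ᶜ, isClosed_closure.isOpen_compl.mem_nhds fun h => hxf ?_,
              1, one_pos, fun z hz hzS => absurd (subset_closure (mem_image_of_mem _ hz)) hzS⟩
            rw [hDo.frontier_eq]
            exact ⟨h, hxD⟩
    obtain ⟨c, hc, h⟩ := huniv
    exact ⟨c, hc, fun z hz => h z hz (mem_univ _)⟩

/-! ### Complementary components of smoothly bounded domains. -/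

/-- If every point of a compact set has a neighbourhood in it that is contained in a nondegenerate
connected subset, then there are finitely many components, all nondegenerate. -/
theorem complementComponents_finite_and_nontrivial {D : Set ℂ} (hD : IsOpen D)
    (h : ∀ x ∈ (toSphere D)ᶜ, ∃ W ⊆ (toSphere D)ᶜ, IsPreconnected W ∧ W.Nontrivial ∧
      ∃ N ∈ 𝓝 x, (toSphere D)ᶜ ∩ N ⊆ W) :
    (complementComponents D).Finite ∧ ∀ C ∈ complementComponents D, C.Nontrivial := by
  choose! W hWF hWc hWnt N hN hNW using h
  have hsub : ∀ x ∈ (toSphere D)ᶜ, ∀ y ∈ (toSphere D)ᶜ ∩ N x,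
      W x ⊆ connectedComponentIn (toSphere D)ᶜ y := fun x hx y hy =>
    (hWc x hx).subset_connectedComponentIn (hNW x hx hy) (hWF x hx)
  have hself : ∀ x ∈ (toSphere D)ᶜ, x ∈ (toSphere D)ᶜ ∩ N x := fun x hx =>
    ⟨hx, mem_of_mem_nhds (hN x hx)⟩
  constructor
  · obtain ⟨t, ht, hcov⟩ := (isOpen_toSphere.2 hD).isClosed_compl.isCompact.elim_nhds_subcover N hN
    refine (t.finite_toSet.image fun x => connectedComponentIn (toSphere D)ᶜ x).subset ?_
    rintro _ ⟨y, hy, rfl⟩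
    obtain ⟨x, hxt, hyx⟩ := mem_iUnion₂.1 (hcov hy)
    refine ⟨x, hxt, (connectedComponentIn_eq ?_).symm⟩
    exact hsub x (ht x hxt) y ⟨hy, hyx⟩ (hNW x (ht x hxt) (hself x (ht x hxt)))
  · rintro _ ⟨x, hx, rfl⟩
    exact (hWnt x hx).mono (hsub x hx x (hself x hx))

theorem nontrivial_ball {z : ℂ} {r : ℝ} (hr : 0 < r) : (ball z r).Nontrivial :=
  ((infinite_of_mem_nhds z (ball_mem_nhds z hr))).nontrivial

theorem isPreconnected_setOf_lt_norm {R : ℝ} (hR : 0 < R) : IsPreconnected {z : ℂ | R < ‖z‖} := by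
  have h1 : {z : ℂ | R < ‖z‖} = Complex.exp '' {z | Real.log R < z.re} := by
    ext z
    constructor
    · intro hz
      have hz0 : z ≠ 0 := norm_pos_iff.1 (hR.trans hz)
      exact ⟨Complex.log z, by simpa [Complex.log_re] using! Real.log_lt_log hR hz, Complex.exp_log hz0⟩
    · rintro ⟨w, hw, rfl⟩
      change R < ‖Complex.exp w‖
      rw [Complex.norm_exp]
      exact (Real.log_lt_iff_lt_exp hR).1 hw
  rw [h1]
  exact (convex_halfSpace_re_gt _).isPreconnected.image _ Complex.continuous_exp.continuousOn

/-- Near a smooth boundary point, the complement of a domain lies in a connected set. -/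
theorem exists_isPreconnected_of_mem_frontier {D U : Set ℂ} {ρ : ℂ → ℝ} {p : ℂ} (hU : IsOpen U)
    (hp : p ∈ U) (hpD : p ∉ D) (hρ : ContDiffOn ℝ 1 ρ U) (hd : fderiv ℝ ρ p ≠ 0)
    (hDU : D ∩ U = {z ∈ U | ρ z < 0}) :
    ∃ W ⊆ Dᶜ, IsPreconnected W ∧ W.Nontrivial ∧ ∃ N ∈ 𝓝 p, Dᶜ ∩ N ⊆ W := by
  obtain ⟨v, hv⟩ : ∃ v, 0 < fderiv ℝ ρ p v := by
    obtain ⟨v, hv⟩ := DFunLike.ne_iff.1 hd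
    rcases lt_or_gt_of_ne hv with h | h
    · exact ⟨-v, by simpa using h⟩
    · exact ⟨v, h⟩
  have hcont : ContinuousAt (fun y => fderiv ℝ ρ y v) p :=
    ((hρ.continuousOn_fderiv_of_isOpen hU le_rfl).continuousAt (hU.mem_nhds hp)).clm_apply
      continuousAt_const
  obtain ⟨ε, hε, hball⟩ := Metric.mem_nhds_iff.1
    (inter_mem (hU.mem_nhds hp) (hcont.eventually (lt_mem_nhds hv)))
  have hmem : ∀ y ∈ U, 0 ≤ ρ y → y ∈ Dᶜ := fun y hy h hyD =>
    absurd (hDU ▸ ⟨hyD, hy⟩ : y ∈ {z ∈ U | ρ z < 0}).2 (not_lt.2 h)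
  have hnonneg : ∀ y ∈ U, y ∈ Dᶜ → 0 ≤ ρ y := fun y hy hyD => by
    by_contra! h
    exact hyD (hDU ▸ ⟨hy, h⟩ : y ∈ D ∩ U).1
  obtain ⟨s, hs, hsv⟩ : ∃ s > 0, s * ‖v‖ < ε / 2 := by
    refine ⟨ε / 2 / (‖v‖ + 1), by positivity, ?_⟩
    rw [div_mul_eq_mul_div, div_lt_iff₀ (by positivity)]
    nlinarith [norm_nonneg v]
  have hpath : ∀ y ∈ ball p (ε / 2), ∀ t ∈ Icc 0 s, y + t • v ∈ ball p ε := fun y hy t ht => by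
    rw [mem_ball_iff_norm] at hy ⊢
    rw [add_sub_right_comm]
    refine (norm_add_le _ _).trans_lt ?_
    rw [norm_smul, Real.norm_of_nonneg ht.1]
    have := mul_le_mul_of_nonneg_right ht.2 (norm_nonneg v)
    linarith
  -- ρ increases along short segments in direction v, so a segment starting in the complement near p
  -- stays there.
  have hmono : ∀ y ∈ ball p (ε / 2), StrictMonoOn (fun t : ℝ => ρ (y + t • v)) (Icc 0 s) := by
    intro y hy
    have hder : ∀ t ∈ Icc 0 s, HasDerivAt (fun t : ℝ => ρ (y + t • v))
        (fderiv ℝ ρ (y + t • v) v) t := fun t ht => by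
      have h1 : HasFDerivAt ρ (fderiv ℝ ρ (y + t • v)) (y + t • v) :=
        ((hρ.contDiffAt (hU.mem_nhds (hball (hpath y hy t ht)).1)).differentiableAt
          one_ne_zero).hasFDerivAt
      have h2 : HasDerivAt (fun t : ℝ => y + t • v) v t := by
        simpa using ((hasDerivAt_id t).smul_const v).const_add y
      exact h1.comp_hasDerivAt t h2
    refine strictMonoOn_of_deriv_pos (convex_Icc 0 s)
      (fun t ht => (hder t ht).continuousAt.continuousWithinAt) fun t ht => ?_
    rw [(hder t (interior_subset ht)).deriv]
    exact (hball (hpath y hy t (interior_subset ht))).2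
  have h0s : (0 : ℝ) ∈ Icc 0 s := left_mem_Icc.2 hs.le
  have hss : s ∈ Icc 0 s := right_mem_Icc.2 hs.le
  have hpε : p ∈ ball p (ε / 2) := mem_ball_self (half_pos hε)
  set q := p + s • v with hq
  have hqε : q ∈ ball p ε := hpath p hpε s hss
  have hqpos : 0 < ρ q := by
    have h1 := hmono p hpε h0s hss hs
    simp only [zero_smul, add_zero] at h1
    exact (hnonneg p hp hpD).trans_lt h1
  obtain ⟨η, hη, hηb⟩ := Metric.mem_nhds_iff.1 (inter_mem (isOpen_ball.mem_nhds hqε)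
    ((hρ.continuousOn.continuousAt (hU.mem_nhds (hball hqε).1)).eventually (lt_mem_nhds hqpos)))
  have hballD : ball q η ⊆ Dᶜ := fun y hy =>
    hmem y (hball (hηb hy).1).1 (le_of_lt (hηb hy).2)
  set δ := min η (ε / 2) with hδ
  have hδ0 : 0 < δ := lt_min hη (half_pos hε)
  set σ : ℂ → Set ℂ := fun y => (fun t : ℝ => y + t • v) '' Icc 0 s with hσ
  have hσD : ∀ y ∈ Dᶜ ∩ ball p δ, σ y ⊆ Dᶜ := by
    rintro y ⟨hyD, hy⟩ _ ⟨t, ht, rfl⟩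
    have hyε : y ∈ ball p (ε / 2) := ball_subset_ball (min_le_right _ _) hy
    have h1 := (hmono y hyε).monotoneOn h0s ht ht.1
    simp only [zero_smul, add_zero] at h1
    have hyU : y ∈ U := (hball (ball_subset_ball (half_le_self hε.le) hyε)).1
    exact hmem _ (hball (hpath y hyε t ht)).1 ((hnonneg y hyU hyD).trans h1)
  have hσc : ∀ y, IsPreconnected (σ y) := fun y =>
    isPreconnected_Icc.image _ (by fun_prop)
  have hσq : ∀ y ∈ ball p δ, y + s • v ∈ ball q η := fun y hy => by
    have : y ∈ ball p η := ball_subset_ball (min_le_left _ _) hy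
    rw [mem_ball_iff_norm] at this ⊢
    rwa [hq, add_sub_add_right_eq_sub]
  have hself : ∀ y, y ∈ σ y := fun y => ⟨0, h0s, by simp⟩
  -- All these segments end in one ball about q, on which ρ > 0; the ball joins them into a
  -- connected set.
  refine ⟨ball q η ∪ ⋃ y ∈ Dᶜ ∩ ball p δ, σ y, union_subset hballD (iUnion₂_subset hσD), ?_,
    (nontrivial_ball hη).mono subset_union_left, ball p δ, ball_mem_nhds p hδ0, fun y hy =>
    Or.inr (mem_iUnion₂.2 ⟨y, hy, hself y⟩)⟩
  refine isPreconnected_of_forall q fun y hy => ?_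
  rcases hy with hy | hy
  · exact ⟨ball q η, subset_union_left, mem_ball_self hη, hy, isPreconnected_ball⟩
  · obtain ⟨x, hx, hyx⟩ := mem_iUnion₂.1 hy
    refine ⟨ball q η ∪ σ x, union_subset_union_right _ (subset_biUnion_of_mem (u := σ) hx),
      Or.inl (mem_ball_self hη), Or.inr hyx, ?_⟩
    exact isPreconnected_ball.union (x + s • v) (hσq x hx.2) ⟨s, hss, rfl⟩ (hσc x)

theorem exists_isPreconnected_of_hasSmoothBoundary {D : Set ℂ}
    (hb : Bornology.IsBounded D) (hs : HasSmoothBoundary D) {x : OnePoint ℂ}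
    (hx : x ∈ (toSphere D)ᶜ) : ∃ W ⊆ (toSphere D)ᶜ, IsPreconnected W ∧ W.Nontrivial ∧
      ∃ N ∈ 𝓝 x, (toSphere D)ᶜ ∩ N ⊆ W := by
  induction x using OnePoint.rec with
  | infty =>
    obtain ⟨R, hR0, hR⟩ := hb.exists_pos_norm_le
    set A : Set (OnePoint ℂ) := (fun z : ℂ => (z : OnePoint ℂ)) '' {z | R < ‖z‖} with hA
    have hAD : insert OnePoint.infty A ⊆ (toSphere D)ᶜ := by
      refine insert_subset hx ?_
      rintro _ ⟨z, hz, rfl⟩ h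
      exact absurd (hR z (coe_mem_toSphere.1 h)) (not_le.2 hz)
    have hev : ∀ᶠ z : ℂ in Bornology.cobounded ℂ, (z : OnePoint ℂ) ∈ A := by
      filter_upwards [tendsto_norm_cobounded_atTop.eventually_gt_atTop R] with z hz
      exact mem_image_of_mem _ hz
    have hcl : OnePoint.infty ∈ closure A := mem_closure_of_tendsto tendsto_coe_cobounded hev
    have hne : A.Nonempty := hev.exists.elim fun z h => ⟨z, h⟩
    refine ⟨insert OnePoint.infty A, hAD, ?_, ?_, insert OnePoint.infty A, ?_, inter_subset_right⟩
    · exact ((isPreconnected_setOf_lt_norm hR0).image _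
        OnePoint.continuous_coe.continuousOn).subset_closure (subset_insert _ _)
        (insert_subset hcl subset_closure)
    · obtain ⟨_, z, hz, rfl⟩ := hne
      exact ⟨_, mem_insert _ _, _, mem_insert_of_mem _ (mem_image_of_mem _ hz),
        OnePoint.infty_ne_coe z⟩
    · rw [OnePoint.nhds_infty_eq, coclosedCompact_eq_cocompact, ← Metric.cobounded_eq_cocompact]
      exact ⟨hev.mono fun z hz => mem_insert_of_mem _ hz, mem_insert _ _⟩
  | coe p =>
    have hpD : p ∉ D := fun h => hx (mem_image_of_mem _ h)
    obtain ⟨W, hWD, hWc, hWnt, N, hN, hNW⟩ : ∃ W ⊆ Dᶜ, IsPreconnected W ∧ W.Nontrivial ∧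
        ∃ N ∈ 𝓝 p, Dᶜ ∩ N ⊆ W := by
      by_cases hpc : p ∈ closure D
      · obtain ⟨U, ρ, hU, hpU, hρ, hd, hDU⟩ :=
          hs p ⟨hpc, fun h => hpD (interior_subset h)⟩
        exact exists_isPreconnected_of_mem_frontier hU hpU hpD (hρ.of_le (by simp)) (hd p hpU) hDU
      · obtain ⟨r, hr, hrD⟩ := Metric.isOpen_iff.1 isClosed_closure.isOpen_compl p hpc
        exact ⟨ball p r, hrD.trans (compl_subset_compl.2 subset_closure), isPreconnected_ball,
          nontrivial_ball hr, ball p r, ball_mem_nhds p hr, inter_subset_right⟩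
    refine ⟨(fun z : ℂ => (z : OnePoint ℂ)) '' W, ?_, hWc.image _
      OnePoint.continuous_coe.continuousOn, hWnt.image OnePoint.coe_injective,
      (fun z : ℂ => (z : OnePoint ℂ)) '' N, OnePoint.isOpenMap_coe.image_mem_nhds hN, ?_⟩
    · rintro _ ⟨z, hz, rfl⟩ h
      exact hWD hz (coe_mem_toSphere.1 h)
    · rintro _ ⟨hz, z, hzN, rfl⟩
      exact mem_image_of_mem _ (hNW ⟨fun h => hz (mem_image_of_mem _ h), hzN⟩)

end Squeezing

theorem mainTheorem4 :
    (∀ D : Set ℂ, Squeezing.IsDomainSet D →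
      (Squeezing.complementComponents D).Finite →
      (∀ C ∈ Squeezing.complementComponents D, C.Nontrivial) →
      Filter.Tendsto (Squeezing.squeezingFunction D) (Squeezing.towardBoundary D) (nhds 1) ∧
        Squeezing.IsHolomorphicHomogeneousRegular D) ∧
    (∀ D : Set ℂ, Squeezing.IsDomainSet D → Bornology.IsBounded D →
      Squeezing.HasSmoothBoundary D →
      Filter.Tendsto (Squeezing.squeezingFunction D) (Squeezing.towardBoundary D) (nhds 1) ∧
        Squeezing.IsHolomorphicHomogeneousRegular D) := by
  refine ⟨fun D hD hfin hnt =>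
    Squeezing.tendsto_and_isHolomorphicHomogeneousRegular hD hfin hnt, fun D hD hb hs => ?_⟩
  obtain ⟨hfin, hnt⟩ := Squeezing.complementComponents_finite_and_nontrivial hD.1
    fun x hx => Squeezing.exists_isPreconnected_of_hasSmoothBoundary hb hs hx
  exact Squeezing.tendsto_and_isHolomorphicHomogeneousRegular hD hfin hnt
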